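/- Let $G$ be a finite, nonempty, connected, undirected graph without multiple edges (self-loops are allowed), with vertex set $V$. Let $X_G\subset V^{\mathbb Z^2}$ be its two-dimensional Hom shift, i.e. the set of all $x$ such that $x_{\mathbf u}$ and $x_{\mathbf v}$ are adjacent in $G$ whenever $\mathbf u,\mathbf v\in\mathbb Z^2$ are nearest neighbours in the grid ($|\mathbf u_1-\mathbf v_1|+|\mathbf u_2-\mathbf v_2|=1$). For $f:\mathbb N^*\to\mathbb N$ and $k\ge 1$, a shift $X$ is $(f,k)$-phased block gluing if for every $n\ge1$, every two globally admissible patterns $p,p'$ on $B_n=\{0,\dots,n-1\}^2$ and every $\mathbf u,\mathbf u'\in\mathbb Z^2$ such that $\mathbf u+B_n$ and $\mathbf u'+B_n$ are at $\|\cdot\|_\infty$-distance at least $f(n)$, there are $x\in X$ and $\mathbf v\in\mathbb Z^2$ with $\|\mathbf v\|_\infty<k$, $x_{\mathbf u+B_n}=p$ and $x_{\mathbf u'+\mathbf v+B_n}=p'$. (A pattern is globally admissible if it appears in some element of $X$.) $X$ is phased block gluing if this holds for some $f$ and $k\ge 1$; its phase $\theta_X$ is then the least $k\geq 1$ for which some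 $f$ exists, and its gap function $\gamma_X$ is the (pointwise) least $f$ such that $X$ is $(f,\theta_X)$-phased block gluing. Write $\gamma_G=\gamma_{X_G}$. A walk is a nonempty word of successively adjacent vertices; it is non-backtracking if it has no subword $aba$ ($a=b$ allowed). Every walk $w$ has a unique reduction $\varphi(w)$, obtained by replacing subwords $aba$ by $a$ until none is left. A square is a non-backtracking closed walk of length $4$. Two non-backtracking walks $p,q$ differ by a square if one of them is the reduction of the word obtained from the other by replacing one of its letters, at some position, by a square starting (and ending) at that letter; let $\sim_\square$ be the equivalence relation generated by this. For $a\in V$, the universal cover $\mathcal U_G[a]$ is the graph of non-backtracking walks starting at $a$, two being adjacent if one extends the other by one letter, and the square cover $\mathcal U_G^\square[a]$ is its quotient graph by $\sim_\square$ (up to isomorphism it does not depend on $a$). For $f,g:\mathbb N^*\to[0,\infty)$ write $g=O(f)$ if there are $c,K>0$ with $g(n)\le c f(n)+K$ for all $n\ge 1$, and $g=\Theta(f)$ if $g=O(f)$ and $f=O(g)$. **Theorem.** $X_G$ is phased block gluing (so that $\gamma_G$ is well defined), and either $\gamma_G(n)=\Theta(n)$ or $\gamma_G(n)=O(\log n)$.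 More precisely, for every vertex $a$ of $G$: $\gamma_G(n)=\Theta(n)$ if and only if the square cover $\mathcal U_G^\square[a]$ is infinite, and $\gamma_G(n)=O(\log n)$ if and only if the square cover $\mathcal U_G^\square[a]$ is finite. -/

import Mathlib

namespace HomShift

/-! ### Two-dimensional shifts and phased block gluing -/

/-- The supremum norm on `ℤ²`. -/
def supNorm (v : ℤ × ℤ) : ℕ := max v.1.natAbs v.2.natAbs

/-- The block `u + ⟦0, n - 1⟧²`. -/
def block (u : ℤ × ℤ) (n : ℕ) : Set (ℤ × ℤ) :=
  {w | u.1 ≤ w.1 ∧ w.1 < u.1 + n ∧ u.2 ≤ w.2 ∧ w.2 < u.2 + n}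

/-- The distance between two (nonempty) subsets of `ℤ²` for the supremum norm. -/
noncomputable def setDist (U U' : Set (ℤ × ℤ)) : ℕ :=
  sInf {m | ∃ w ∈ U, ∃ w' ∈ U', m = supNorm (w - w')}

/-- Block patterns of size `n` over the alphabet `A`. -/
abbrev BlockPattern (A : Type*) (n : ℕ) := Fin n × Fin n → A

/-- The restriction of `x` to `u + ⟦0, n - 1⟧²` is the pattern `p`. -/
def AppearsAt {A : Type*} {n : ℕ} (x : ℤ × ℤ → A) (u : ℤ × ℤ) (p : BlockPattern A n) : Prop :=
  ∀ i j : Fin n, x (u.1 + (i : ℤ), u.2 + (j : ℤ)) = p (i, j)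

/-- A block pattern is globally admissible for `X` if it appears in some element of `X`. -/
def GloballyAdmissible {A : Type*} {n : ℕ} (X : Set (ℤ × ℤ → A)) (p : BlockPattern A n) : Prop :=
  ∃ x ∈ X, ∃ u : ℤ × ℤ, AppearsAt x u p

/-- The gluing condition for block patterns of size `n`, with gap `m` and phase bound `k`. -/
def GluesAt {A : Type*} (X : Set (ℤ × ℤ → A)) (k n m : ℕ) : Prop :=
  ∀ p p' : BlockPattern A n, GloballyAdmissible X p → GloballyAdmissible X p' →
    ∀ u u' : ℤ × ℤ, m ≤ setDist (block u n) (block u' n) →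
      ∃ x ∈ X, ∃ v : ℤ × ℤ, supNorm v < k ∧ AppearsAt x u p ∧ AppearsAt x (u' + v) p'

/-- `X` is `(f, k)`-phased block gluing. -/
def IsPhasedBlockGluingWith {A : Type*} (X : Set (ℤ × ℤ → A)) (f : ℕ+ → ℕ) (k : ℕ) : Prop :=
  ∀ n : ℕ+, GluesAt X k n (f n)

/-- `X` is phased block gluing: `(f, k)`-phased block gluing for some `f` and some `k ≥ 1`. -/
def IsPhasedBlockGluing {A : Type*} (X : Set (ℤ × ℤ → A)) : Prop :=
  ∃ k : ℕ, 1 ≤ k ∧ ∃ f : ℕ+ → ℕ, IsPhasedBlockGluingWith X f k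

/-- The phase of `X`: the least `k ≥ 1` such that `X` is `(f, k)`-phased block gluing for
some `f`. -/
noncomputable def phase {A : Type*} (X : Set (ℤ × ℤ → A)) : ℕ :=
  sInf {k : ℕ | 1 ≤ k ∧ ∃ f : ℕ+ → ℕ, IsPhasedBlockGluingWith X f k}

/-- The gap function of `X`; by `isLeast_gapFunction` it is the least function `f` such that
`X` is `(f, phase X)`-phased block gluing. -/
noncomputable def gapFunction {A : Type*} (X : Set (ℤ × ℤ → A)) (n : ℕ+) : ℕ :=
  sInf {m : ℕ | GluesAt X (phase X) n m}

theorem isLeast_gapFunction {A : Type*} {X : Set (ℤ × ℤ → A)} (hX : IsPhasedBlockGluing X) :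
    IsLeast {f : ℕ+ → ℕ | IsPhasedBlockGluingWith X f (phase X)} (gapFunction X) := by
  obtain ⟨-, f, hf⟩ : phase X ∈ {k : ℕ | 1 ≤ k ∧ ∃ f : ℕ+ → ℕ, IsPhasedBlockGluingWith X f k} :=
    Nat.sInf_mem hX
  exact ⟨fun n => Nat.sInf_mem (s := {m : ℕ | GluesAt X (phase X) n m}) ⟨f n, hf n⟩,
    fun g hg n => Nat.sInf_le (hg n)⟩

/-- `g = O(f)`: there are `c, K > 0` with `g n ≤ c * f n + K` for all `n ≥ 1`. -/
def IsO (g f : ℕ+ → ℝ) : Prop :=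
  ∃ c > 0, ∃ K > 0, ∀ n : ℕ+, g n ≤ c * f n + K

/-- `g = Θ(f)`. -/
def IsTheta (g f : ℕ+ → ℝ) : Prop := IsO g f ∧ IsO f g

/-! ### Graphs and Hom shifts -/

/-- Undirected graphs without multiple edges, in which self-loops are allowed. -/
structure LoopGraph (V : Type*) where
  Adj : V → V → Prop
  symm : ∀ a b, Adj a b → Adj b a

variable {V : Type*}

/-- A graph is connected if it is nonempty and any two vertices are joined by a walk. -/
def LoopGraph.Connected (G : LoopGraph V) : Prop :=
  Nonempty V ∧ ∀ a b : V, Relation.ReflTransGen G.Adj a b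

/-- The two-dimensional Hom shift `X_G`: graph homomorphisms from the grid `ℤ²` to `G`. -/
def homShift (G : LoopGraph V) : Set (ℤ × ℤ → V) :=
  {x | ∀ u v : ℤ × ℤ, (u.1 - v.1).natAbs + (u.2 - v.2).natAbs = 1 → G.Adj (x u) (x v)}

/-! ### The universal cover and the square cover -/

/-- Walks, as words on the set of vertices; the length of the walk `p` is `p.length - 1`. -/
def IsWalk (G : LoopGraph V) (p : List V) : Prop := p ≠ [] ∧ p.IsChain G.Adj

/-- A word is non-backtracking if it has no subword of the form `a b a`. -/
def NonBacktracking (p : List V) : Prop := ∀ a b : V, ¬ [a, b, a] <:+: p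

/-- Replacing one subword `a b a` by `a`. -/
inductive SpineRemoval : List V → List V → Prop
  | intro (l r : List V) (a b : V) : SpineRemoval (l ++ [a, b, a] ++ r) (l ++ [a] ++ r)

/-- `q` is obtained from `p` by successively replacing subwords `a b a` by `a` until there is
none left. -/
def IsReduction (p q : List V) : Prop :=
  Relation.ReflTransGen SpineRemoval p q ∧ NonBacktracking q

/-- A square: a non-backtracking cycle of length four. -/
def IsSquare (G : LoopGraph V) (s : List V) : Prop :=
  IsWalk G s ∧ NonBacktracking s ∧ s.length = 5 ∧ s.head? = s.getLast?

/-- The word `p_0 … p_{k-1} s p_{k+1} … `, where the letter `p_k` is replaced by `s`. -/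
def insertAt (p : List V) (k : ℕ) (s : List V) : List V := p.take k ++ s ++ p.drop (k + 1)

/-- `q` is the reduction of `p` with a square inserted at some position. -/
def AddsSquare (G : LoopGraph V) (p q : List V) : Prop :=
  ∃ (k : ℕ) (s : List V), k < p.length ∧ IsSquare G s ∧ s.head? = p[k]? ∧
    IsReduction (insertAt p k s) q

/-- `p` and `q` differ by a square. -/
def DifferBySquare (G : LoopGraph V) (p q : List V) : Prop :=
  AddsSquare G p q ∨ AddsSquare G q p

/-- The vertices of the universal cover based at `a`: the non-backtracking walks from `a`. -/
def UniversalCoverVertex (G : LoopGraph V) (a : V) : Type _ :=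
  {p : List V // IsWalk G p ∧ NonBacktracking p ∧ p.head? = some a}

/-- The universal cover of `G`, based at `a`. -/
def universalCover (G : LoopGraph V) (a : V) : LoopGraph (UniversalCoverVertex G a) where
  Adj p q := ∃ v : V, p.1 = q.1 ++ [v] ∨ q.1 = p.1 ++ [v]
  symm _ _ := fun ⟨v, h⟩ => ⟨v, h.symm⟩

/-- The equivalence relation generated by differing by a square. -/
def squareSetoid (G : LoopGraph V) (a : V) : Setoid (UniversalCoverVertex G a) :=
  Relation.EqvGen.setoid fun p q => DifferBySquare G p.1 q.1

/-- The vertices of the square cover based at `a`. -/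
def SquareCoverVertex (G : LoopGraph V) (a : V) : Type _ := Quotient (squareSetoid G a)

/-- The square cover of `G`, based at `a`: the quotient of the universal cover by
`squareSetoid`. Two classes are adjacent if they have adjacent representatives. -/
def squareCover (G : LoopGraph V) (a : V) : LoopGraph (SquareCoverVertex G a) where
  Adj P Q := ∃ p q : UniversalCoverVertex G a,
    Quotient.mk (squareSetoid G a) p = P ∧ Quotient.mk (squareSetoid G a) q = Q ∧
      (universalCover G a).Adj p q
  symm _ _ := fun ⟨p, q, hp, hq, h⟩ => ⟨q, p, hq, hp, (universalCover G a).symm p q h⟩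

/-- A graph is finite if its vertex set is. -/
def LoopGraph.IsFinite (_G : LoopGraph V) : Prop := Finite V

end HomShift

namespace HomShift

variable {V : Type*} {G : LoopGraph V}

/-! ### Folding the line onto a segment -/

/-! Filling the strip between two blocks means finding a path of rows. It is enough to deform the
boundary row of each block, folded outside the block, into a row alternating between two letters.
Two alternating rows are then joined by a walk of prescribed length in the graph, and a shift of one
block by one column removes any parity obstruction, so the phase is at most 2
(`gluesAt_of_unwinds`). Sliding a walk along itself flattens a row of length `n` in `n` steps, which
gives the linear upper bound for every graph (`unwinds_linear`).

Lower bound: a filled rectangle is a homotopy in which backtracks and squares are inserted or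
removed. It makes its bottom row homotopic to left side, top row, right side. If the top row
alternates, few letters beyond the two sides remain. A gap well below `n / 2` would therefore make
every walk of a certain length homotopic to a shorter word, and the square cover would be finite
(`squareCover_isFinite_of_gluesAt`). This uses that homotopic walks have equivalent reductions, the
main point being that the square equivalence is compatible with extending walks (`AddsSquare.push`).

Logarithmic upper bound: if the square cover is finite, every walk from `a` is equivalent to one of
finitely many representatives, so a representative can absorb one more letter in bounded time once
enough oscillations stand in front of it (`exists_absorber`). Lengths are preserved, so absorbed
letters become oscillations, and an oscillation crosses a walk of any length in one move
(`zig_shift`). Oscillations carried to the midpoint of a long loop are unfolded into a detour to `a`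
and back. The two halves are then treated simultaneously, so about `log n` rounds suffice
(`Absorber.contract`). Linear growth and logarithmic growth exclude each other, which turns the two
implications into equivalences. -/

/-- The retraction of `ℤ` onto `⟦0, n⟧` which oscillates at both ends. -/
def foldInt (n i : ℤ) : ℤ := if i < 0 then i % 2 else if n < i then n - (i - n) % 2 else i

theorem foldInt_nonneg {n : ℤ} (hn : 1 ≤ n) (i : ℤ) : 0 ≤ foldInt n i := by
  unfold foldInt; split_ifs <;> omega

theorem foldInt_le {n : ℤ} (hn : 1 ≤ n) (i : ℤ) : foldInt n i ≤ n := by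
  unfold foldInt; split_ifs <;> omega

theorem foldInt_succ {n : ℤ} (hn : 1 ≤ n) (i : ℤ) :
    foldInt n (i + 1) = foldInt n i + 1 ∨ foldInt n (i + 1) = foldInt n i - 1 := by
  unfold foldInt; split_ifs <;> omega

theorem foldInt_of_mem {n i : ℤ} (h0 : 0 ≤ i) (hi : i ≤ n) : foldInt n i = i := by
  unfold foldInt; split_ifs <;> omega

theorem foldInt_emod_two (n i : ℤ) : foldInt n i % 2 = i % 2 := by
  unfold foldInt; split_ifs <;> omega

theorem foldInt_of_ge {n i : ℤ} (hn : 0 ≤ n) (hi : n ≤ i) : foldInt n i = n - (i - n) % 2 := by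
  unfold foldInt; split_ifs <;> omega

/-! ### Rows -/

/-- Bi-infinite walks. -/
def RowWalk (G : LoopGraph V) (r : ℤ → V) : Prop := ∀ i, G.Adj (r i) (r (i + 1))

/-- `RowReach G t r r'`: the row `r'` can be placed at height `t` above the row `r`. -/
inductive RowReach (G : LoopGraph V) : ℕ → (ℤ → V) → (ℤ → V) → Prop
  | refl {r : ℤ → V} : RowWalk G r → RowReach G 0 r r
  | step {t : ℕ} {r r' r'' : ℤ → V} : RowWalk G r → (∀ i, G.Adj (r i) (r' i)) →
      RowReach G t r' r'' → RowReach G (t + 1) r r''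

theorem RowReach.walk_left {t : ℕ} {r r' : ℤ → V} (h : RowReach G t r r') : RowWalk G r := by
  cases h <;> assumption

theorem RowReach.walk_right {t : ℕ} {r r' : ℤ → V} (h : RowReach G t r r') : RowWalk G r' := by
  induction h <;> assumption

theorem RowReach.trans {t t' : ℕ} {r r' r'' : ℤ → V} (h : RowReach G t r r')
    (h' : RowReach G t' r' r'') : RowReach G (t + t') r r'' := by
  induction h with
  | refl _ => simpa using h'
  | step hw ha _ ih =>
    rw [Nat.add_right_comm]
    exact .step hw ha (ih h')

theorem RowReach.symm {t : ℕ} {r r' : ℤ → V} (h : RowReach G t r r') : RowReach G t r' r := by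
  induction h with
  | refl hw => exact .refl hw
  | step hw ha h ih =>
    exact ih.trans (.step h.walk_left (fun i => G.symm _ _ (ha i)) (.refl hw))

theorem RowReach.translate {t : ℕ} {r r' : ℤ → V} (h : RowReach G t r r') (c : ℤ) :
    RowReach G t (fun i => r (i - c)) (fun i => r' (i - c)) := by
  have aux : ∀ r : ℤ → V, RowWalk G r → RowWalk G (fun i => r (i - c)) := by
    intro r hr i
    have := hr (i - c)
    rwa [show i - c + 1 = i + 1 - c by ring] at this
  induction h with
  | refl hw => exact .refl (aux _ hw)
  | step hw ha h ih => exact .step (aux _ hw) (fun i => ha _) ih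

theorem rowWalk_fold {n : ℤ} (hn : 1 ≤ n) {r : ℤ → V}
    (h : ∀ i, 0 ≤ i → i < n → G.Adj (r i) (r (i + 1))) : RowWalk G (fun i => r (foldInt n i)) := by
  intro i
  have h0 := foldInt_nonneg hn i
  have h1 := foldInt_le hn i
  have h0' := foldInt_nonneg hn (i + 1)
  have h1' := foldInt_le hn (i + 1)
  rcases foldInt_succ hn i with e | e
  · have := h (foldInt n i) h0 (by omega)
    rwa [← e] at this
  · have := h (foldInt n (i + 1)) h0' (by omega)
    rw [show foldInt n (i + 1) + 1 = foldInt n i by omega] at this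
    exact G.symm _ _ this

/-- The row alternating between `α` and `β`. -/
def checker (α β : V) (i : ℤ) : V := if i % 2 = 0 then α else β

theorem checker_walk {α β : V} (h : G.Adj α β) : RowWalk G (checker α β) := by
  intro i
  rcases Int.emod_two_eq_zero_or_one i with e | e
  · rw [checker, checker, if_pos e, if_neg (by omega)]; exact h
  · rw [checker, checker, if_neg (by omega), if_pos (by omega)]; exact G.symm _ _ h

theorem checker_translate (α β : V) (c : ℤ) :
    (fun i => checker α β (i - c)) = checker α β ∨ (fun i => checker α β (i - c)) = checker β α := by
  rcases Int.emod_two_eq_zero_or_one c with e | e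
  · left; funext i; simp only [checker, show (i - c) % 2 = i % 2 by omega]
  · right; funext i
    rcases Int.emod_two_eq_zero_or_one i with e' | e'
    · rw [checker, checker, if_neg (by omega), if_pos e']
    · rw [checker, checker, if_pos (by omega), if_neg (by omega)]

/-- This exchange of letters is what a phase of 2 buys. -/
theorem checker_translate_one (α β : V) : (fun i => checker α β (i - 1)) = checker β α := by
  funext i
  rcases Int.emod_two_eq_zero_or_one i with e' | e'
  · rw [checker, checker, if_neg (by omega), if_pos e']
  · rw [checker, checker, if_pos (by omega), if_neg (by omega)]

/-! ### Finite walks -/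

/-- `Wk G x s y`: the word `x s` is a walk ending at `y`. -/
inductive Wk (G : LoopGraph V) : V → List V → V → Prop
  | nil (x : V) : Wk G x [] x
  | cons {x y z : V} {s : List V} : G.Adj x y → Wk G y s z → Wk G x (y :: s) z

theorem Wk.append {x y z : V} {s t : List V} (h : Wk G x s y) (h' : Wk G y t z) :
    Wk G x (s ++ t) z := by
  induction h with
  | nil _ => exact h'
  | cons ha _ ih => exact .cons ha (ih h')

theorem Wk.unappend {x z : V} {s t : List V} (h : Wk G x (s ++ t) z) :
    ∃ y, Wk G x s y ∧ Wk G y t z := by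
  induction s generalizing x with
  | nil => exact ⟨x, .nil x, h⟩
  | cons a s ih =>
    cases h with
    | cons ha h =>
      obtain ⟨y, h1, h2⟩ := ih h
      exact ⟨y, .cons ha h1, h2⟩

theorem Wk.end_unique {x y z : V} {s : List V} (h : Wk G x s y) (h' : Wk G x s z) : y = z := by
  induction h with
  | nil _ => cases h'; rfl
  | cons _ _ ih => cases h' with | cons _ h' => exact ih h'

theorem Wk.single {x y : V} (h : G.Adj x y) : Wk G x [y] y := .cons h (.nil y)

/-- The pair of alternating letters slides along the walk from `α` through `β` and `s` to `β'`, one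
edge per row. -/
theorem checker_reach {α β α' β' : V} {s : List V} (h : G.Adj α β) (h' : G.Adj α' β')
    (hs : Wk G β s α') : RowReach G (s.length + 1) (checker α β) (checker α' β') := by
  induction hs generalizing α with
  | nil x =>
    refine .step (checker_walk h) (fun i => ?_) (.refl (checker_walk h'))
    unfold checker; split_ifs <;> assumption
  | cons ha _ ih =>
    refine .step (checker_walk h) (fun i => ?_) (ih ha h')
    unfold checker; split_ifs <;> assumption

/-! ### Configurations -/

theorem mem_homShift_iff {x : ℤ × ℤ → V} : x ∈ homShift G ↔
    (∀ i j, G.Adj (x (i, j)) (x (i + 1, j))) ∧ ∀ i j, G.Adj (x (i, j)) (x (i, j + 1)) := by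
  constructor
  · intro h
    exact ⟨fun i j => h _ _ (by simp), fun i j => h _ _ (by simp)⟩
  · rintro ⟨h1, h2⟩ ⟨i, j⟩ ⟨i', j'⟩ h
    simp only at h
    have : (i' = i + 1 ∧ j' = j) ∨ (i = i' + 1 ∧ j' = j) ∨ (i' = i ∧ j' = j + 1) ∨
        (i' = i ∧ j = j' + 1) := by omega
    rcases this with ⟨rfl, rfl⟩ | ⟨rfl, rfl⟩ | ⟨rfl, rfl⟩ | ⟨rfl, rfl⟩
    · exact h1 _ _
    · exact G.symm _ _ (h1 _ _)
    · exact h2 _ _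
    · exact G.symm _ _ (h2 _ _)

theorem translate_mem {x : ℤ × ℤ → V} (hx : x ∈ homShift G) (v : ℤ × ℤ) :
    (fun w => x (w + v)) ∈ homShift G := by
  intro a b hab
  refine hx _ _ ?_
  simpa using hab

theorem swap_mem {x : ℤ × ℤ → V} (hx : x ∈ homShift G) :
    (fun w => x w.swap) ∈ homShift G := by
  intro a b hab
  refine hx _ _ ?_
  simpa [add_comm] using hab

theorem RowReach.glue {D : ℕ} {r r' : ℤ → V} (h : RowReach G D r r') {x x' : ℤ × ℤ → V} {b : ℤ}
    (hx : x ∈ homShift G) (hx' : x' ∈ homShift G) (hr : ∀ i, x (i, b) = r i)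
    (hr' : ∀ i, x' (i, b + D) = r' i) :
    ∃ z ∈ homShift G, (∀ i j, j ≤ b → z (i, j) = x (i, j)) ∧
      ∀ i j, b + D ≤ j → z (i, j) = x' (i, j) := by
  induction h generalizing x b with
  | @refl r hw =>
    rw [mem_homShift_iff] at hx hx'
    refine ⟨fun w => if w.2 ≤ b then x w else x' w, ?_, ?_, ?_⟩
    · rw [mem_homShift_iff]
      refine ⟨fun i j => ?_, fun i j => ?_⟩
      · dsimp only; split_ifs
        · exact hx.1 _ _
        · exact hx'.1 _ _
      · dsimp only; split_ifs with h1 h2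
        · exact hx.2 _ _
        · have : j = b := by omega
          subst this
          have := hx'.2 i j
          have e := hr' i
          simp only [Nat.cast_zero, add_zero] at e
          rwa [e, ← hr] at this
        · omega
        · exact hx'.2 _ _
    · intro i j hj; simp [hj]
    · intro i j hj
      simp only [Nat.cast_zero, add_zero] at hj hr'
      dsimp only; split_ifs with h1
      · have : j = b := by omega
        subst this
        rw [hr, hr']
      · rfl
  | @step t r r1 r'' hw ha h ih =>
    have hw1 := h.walk_left
    rw [mem_homShift_iff] at hx
    obtain ⟨z, hz, hz1, hz2⟩ := ih (b := b + 1)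
      -- Only row `b + 1` of this configuration and the rows below it matter. Above `b` it
      -- alternates between `r1` and `r` merely to stay in the shift.
      (x := fun w => if w.2 ≤ b then x w else if (w.2 - b) % 2 = 1 then r1 w.1 else r w.1) (by
        rw [mem_homShift_iff]
        refine ⟨fun i j => ?_, fun i j => ?_⟩
        · dsimp only; split_ifs
          · exact hx.1 _ _
          · exact hw1 _
          · exact hw _
        · dsimp only
          split_ifs <;> first
            | omega
            | exact hx.2 _ _
            | exact ha _
            | exact G.symm _ _ (ha _)
            | (have : j = b := by omega
               subst this
               rw [hr]; exact ha _)) (by simp) (by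
        intro i; rw [← hr' i]; congr 2; push_cast; ring)
    refine ⟨z, hz, fun i j hj => ?_, fun i j hj => hz2 i j (by push_cast at hj; omega)⟩
    rw [hz1 i j (by omega)]; simp [hj]

/-! ### Gluing blocks through alternating rows -/

/-- Every walk of length `n`, extended to a row by folding, reaches an alternating row in at most
`T` steps. -/
def Unwinds (G : LoopGraph V) (n T : ℕ) : Prop :=
  ∀ r : ℤ → V, RowWalk G r → ∃ t ≤ T, ∃ α β : V, G.Adj α β ∧
    RowReach G t (fun i => r (foldInt n i)) (checker α β)

/-- Walks of all large lengths exist between any two vertices, up to moving the end point to a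
neighbour if `k ≥ 2`. -/
def Mixes (G : LoopGraph V) (k T : ℕ) : Prop :=
  ∀ t ≥ T, ∀ a b b' : V, G.Adj b b' → (∃ s, Wk G a s b ∧ s.length = t) ∨
    (2 ≤ k ∧ ∃ s, Wk G a s b' ∧ s.length = t)

/-- Folding with parameter `n` retains `n + 1` columns, one more than a block has, so that there is
room to oscillate even for `n = 1`. -/
theorem foldColumns_mem {n : ℤ} (hn : 1 ≤ n) {x : ℤ × ℤ → V} (hx : x ∈ homShift G)
    (w u : ℤ × ℤ) :
    (fun v : ℤ × ℤ => x (w.1 + foldInt n (v.1 - u.1), w.2 + (v.2 - u.2))) ∈ homShift G := by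
  rw [mem_homShift_iff] at hx ⊢
  refine ⟨fun i j => ?_, fun i j => ?_⟩
  · have := rowWalk_fold (G := G) hn (r := fun i => x (w.1 + i, w.2 + (j - u.2)))
      (fun i _ _ => by simpa [add_assoc] using hx.1 (w.1 + i) (w.2 + (j - u.2))) (i - u.1)
    dsimp only at this ⊢
    rwa [show i - u.1 + 1 = i + 1 - u.1 by ring] at this
  · have := hx.2 (w.1 + foldInt n (i - u.1)) (w.2 + (j - u.2))
    dsimp only
    rwa [show w.2 + (j - u.2) + 1 = w.2 + (j + 1 - u.2) by ring] at this

theorem Unwinds.fold_row {n T : ℕ} (h : Unwinds G n T) {x : ℤ × ℤ → V}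
    (hx : x ∈ homShift G) (w : ℤ × ℤ) (c : ℤ) :
    ∃ t ≤ T, ∃ α β : V, G.Adj α β ∧
      RowReach G t (fun i => x (w.1 + foldInt n (i - c), w.2)) (checker α β) := by
  rw [mem_homShift_iff] at hx
  obtain ⟨t, ht, α, β, hαβ, hr⟩ := h (fun i => x (w.1 + i, w.2)) (fun i => by
    simpa [add_assoc] using hx.1 (w.1 + i) w.2)
  have := hr.translate c
  rcases checker_translate α β c with e | e <;> rw [e] at this
  · exact ⟨t, ht, α, β, hαβ, this⟩
  · exact ⟨t, ht, β, α, G.symm _ _ hαβ, this⟩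

/-- Two patterns of size `n` can be glued with phase `k` at the positions `u` and `u'`. -/
def Glued (X : Set (ℤ × ℤ → V)) (k : ℕ) {n : ℕ} (p p' : BlockPattern V n) (u u' : ℤ × ℤ) : Prop :=
  ∃ x ∈ X, ∃ v : ℤ × ℤ, supNorm v < k ∧ AppearsAt x u p ∧ AppearsAt x (u' + v) p'

theorem glued_above {n T k T0 D : ℕ} (hn : 1 ≤ n) (hk : 1 ≤ k) (hT : Unwinds G n T)
    (hM : Mixes G k T0) (hD : 2 * T + T0 + 1 ≤ D) {p p' : BlockPattern V n}
    (hp : GloballyAdmissible (homShift G) p) (hp' : GloballyAdmissible (homShift G) p')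
    {u u' : ℤ × ℤ} (hu : u.2 + (n - 1) + D = u'.2) : Glued (homShift G) k p p' u u' := by
  obtain ⟨x, hx, w, hw⟩ := hp
  obtain ⟨x', hx', w', hw'⟩ := hp'
  have hn' : (1 : ℤ) ≤ n := by exact_mod_cast hn
  obtain ⟨t1, ht1, α, β, hαβ, h1⟩ := hT.fold_row hx (w.1, w.2 + (n - 1)) u.1
  obtain ⟨t2, ht2, α', β', hαβ', h2⟩ := hT.fold_row hx' w' u'.1
  -- The connecting walk gets the rows left over by the two unwindings. If it can only end at `β'`
  -- instead of `α'`, shifting the upper block by one column exchanges these two letters.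
  obtain ⟨c, hc, γ, δ, hγδ, s, hs, hsl, h2'⟩ : ∃ c : ℤ, supNorm (c, 0) < k ∧ ∃ γ δ, G.Adj γ δ ∧
      ∃ s, Wk G β s γ ∧ s.length = D - t1 - t2 - 1 ∧
      RowReach G t2 (fun i => x' (w'.1 + foldInt n (i - (u'.1 + c)), w'.2)) (checker γ δ) := by
    rcases hM (D - t1 - t2 - 1) (by omega) β α' β' hαβ' with ⟨s, hs, hsl⟩ | ⟨hk, s, hs, hsl⟩
    · exact ⟨0, by simp [supNorm]; omega, α', β', hαβ', s, hs, hsl, by simpa using h2⟩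
    · refine ⟨1, by simp [supNorm]; omega, β', α', G.symm _ _ hαβ', s, hs, hsl, ?_⟩
      have := h2.translate 1
      rw [checker_translate_one] at this
      simpa only [sub_sub, add_comm (1 : ℤ)] using this
  have hR := (h1.trans (checker_reach hαβ hγδ hs)).trans h2'.symm
  rw [hsl, show t1 + (D - t1 - t2 - 1 + 1) + t2 = D by omega] at hR
  obtain ⟨z, hz, hz1, hz2⟩ := hR.glue (b := u.2 + (n - 1))
    (foldColumns_mem hn' hx w u) (foldColumns_mem hn' hx' w' (u'.1 + c, u'.2))
    (fun i => by simp) (fun i => by simp [hu])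
  refine ⟨z, hz, (c, 0), hc, fun i j => ?_, fun i j => ?_⟩
  · rw [hz1 _ _ (by omega)]
    simp only [add_sub_cancel_left]
    rw [foldInt_of_mem (by omega) (by omega)]
    exact hw i j
  · rw [hz2 _ _ (by simp only [Prod.snd_add]; omega)]
    simp only [Prod.fst_add, Prod.snd_add, add_zero, add_sub_cancel_left]
    rw [foldInt_of_mem (by omega) (by omega)]
    exact hw' i j

/-- Translating the configuration by `v` puts the second block in its exact place and transfers the
phase, with opposite sign, to the first. -/
theorem glued_symm {k n : ℕ} {p p' : BlockPattern V n} {u u' : ℤ × ℤ}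
    (h : Glued (homShift G) k p p' u u') : Glued (homShift G) k p' p u' u := by
  obtain ⟨x, hx, v, hv, h1, h2⟩ := h
  refine ⟨_, translate_mem hx v, -v, by simpa [supNorm] using hv, fun i j => ?_, fun i j => ?_⟩
  · rw [← h2 i j]; refine congrArg x ?_; apply Prod.ext <;> simp <;> ring
  · rw [← h1 i j]; refine congrArg x ?_; apply Prod.ext <;> simp <;> ring

theorem glued_vertical {n T k T0 : ℕ} (hn : 1 ≤ n) (hk : 1 ≤ k) (hT : Unwinds G n T)
    (hM : Mixes G k T0) {p p' : BlockPattern V n}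
    (hp : GloballyAdmissible (homShift G) p) (hp' : GloballyAdmissible (homShift G) p')
    {u u' : ℤ × ℤ} (hu : 2 * T + T0 + 1 + (n - 1) ≤ (u'.2 - u.2).natAbs) :
    Glued (homShift G) k p p' u u' := by
  rcases le_total u.2 u'.2 with h | h
  · exact glued_above (D := (u'.2 - u.2).natAbs - (n - 1)) hn hk hT hM (by omega) hp hp'
      (by omega)
  · exact glued_symm (glued_above (D := (u'.2 - u.2).natAbs - (n - 1)) hn hk hT hM (by omega)
      hp' hp (by omega))

theorem globallyAdmissible_swap {n : ℕ} {p : BlockPattern V n}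
    (hp : GloballyAdmissible (homShift G) p) :
    GloballyAdmissible (homShift G) (fun w => p w.swap) := by
  obtain ⟨x, hx, w, hw⟩ := hp
  exact ⟨_, swap_mem hx, w.swap, fun i j => hw j i⟩

theorem glued_horizontal {n T k T0 : ℕ} (hn : 1 ≤ n) (hk : 1 ≤ k) (hT : Unwinds G n T)
    (hM : Mixes G k T0) {p p' : BlockPattern V n}
    (hp : GloballyAdmissible (homShift G) p) (hp' : GloballyAdmissible (homShift G) p')
    {u u' : ℤ × ℤ} (hu : 2 * T + T0 + 1 + (n - 1) ≤ (u'.1 - u.1).natAbs) :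
    Glued (homShift G) k p p' u u' := by
  obtain ⟨x, hx, v, hv, h1, h2⟩ := glued_vertical hn hk hT hM (globallyAdmissible_swap hp)
    (globallyAdmissible_swap hp') (u := u.swap) (u' := u'.swap) hu
  exact ⟨_, swap_mem hx, v.swap, by simpa [supNorm, max_comm] using hv, fun i j => h1 j i,
    fun i j => h2 j i⟩

theorem le_setDist_block {n m : ℕ} (hn : 1 ≤ n) (hm : 1 ≤ m) {u u' : ℤ × ℤ}
    (h : m ≤ setDist (block u n) (block u' n)) :
    m + (n - 1) ≤ (u'.1 - u.1).natAbs ∨ m + (n - 1) ≤ (u'.2 - u.2).natAbs := by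
  by_contra hcon
  push Not at hcon
  obtain ⟨h1, h2⟩ := hcon
  have key : ∀ a b : ℤ, (b - a).natAbs < m + (n - 1) → ∃ c d : ℤ, a ≤ c ∧ c < a + n ∧ b ≤ d ∧
      d < b + n ∧ (c - d).natAbs < m := by
    intro a b hab
    -- Each point is the left end of the other interval, clamped to its own interval.
    refine ⟨max a (min b (a + n - 1)), max b (min a (b + n - 1)), ?_⟩
    omega
  obtain ⟨c, d, hc⟩ := key _ _ h1
  obtain ⟨c', d', hc'⟩ := key _ _ h2
  have : setDist (block u n) (block u' n) ≤ supNorm ((c, c') - (d, d')) :=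
    Nat.sInf_le ⟨(c, c'), ⟨hc.1, hc.2.1, hc'.1, hc'.2.1⟩, (d, d'),
      ⟨hc.2.2.1, hc.2.2.2.1, hc'.2.2.1, hc'.2.2.2.1⟩, rfl⟩
  have h3 : supNorm ((c, c') - (d, d')) < m := by
    simp only [supNorm, Prod.mk_sub_mk]; omega
  omega

theorem gluesAt_of_unwinds {n T k T0 : ℕ} (hn : 1 ≤ n) (hk : 1 ≤ k) (hT : Unwinds G n T)
    (hM : Mixes G k T0) : GluesAt (homShift G) k n (2 * T + T0 + 1) := by
  intro p p' hp hp' u u' hu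
  rcases le_setDist_block hn (by omega) hu with h | h
  · exact glued_horizontal hn hk hT hM hp hp' h
  · exact glued_vertical hn hk hT hM hp hp' h

/-- Each new row reads the folded walk one position further to the right. After `n` steps the whole
window lies in the oscillating part beyond the right end. The outer fold restricts the reading to
the window. -/
theorem unwinds_linear (G : LoopGraph V) {n : ℕ} (hn : 1 ≤ n) : Unwinds G n n := by
  intro r hr
  have hn' : (1 : ℤ) ≤ n := by exact_mod_cast hn
  refine ⟨n, le_rfl, ?_⟩
  have hwalk : ∀ c : ℤ, RowWalk G (fun i => r (foldInt n (i + c))) := by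
    intro c i
    have := rowWalk_fold (G := G) hn' (r := r) (fun i _ _ => hr i) (i + c)
    rwa [show i + c + 1 = i + 1 + c by ring] at this
  have hreach : ∀ t : ℕ, RowReach G t (fun i => r (foldInt n (foldInt n i)))
      (fun i => r (foldInt n (foldInt n i + t))) := by
    intro t
    induction t with
    | zero =>
      simp only [Nat.cast_zero, add_zero]
      refine .refl (rowWalk_fold hn' (r := fun i => r (foldInt n i)) fun i _ _ => ?_)
      simpa using hwalk 0 i
    | succ t ih =>
      refine ih.trans (.step ih.walk_right (fun i => ?_) (.refl ?_))
      · have := hwalk t (foldInt n i)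
        dsimp only at this
        rw [show foldInt n i + 1 + (t : ℤ) = foldInt n i + ((t + 1 : ℕ) : ℤ) by push_cast; ring]
          at this
        exact this
      · exact rowWalk_fold hn' (r := fun i => r (foldInt n (i + (t + 1 : ℕ))))
          fun i _ _ => hwalk _ i
  have h0 : ∀ i, foldInt n (foldInt n i) = foldInt (n : ℤ) i := fun i =>
    foldInt_of_mem (foldInt_nonneg hn' i) (foldInt_le hn' i)
  have hfin : (fun i => r (foldInt n (foldInt n i + n))) = checker (r n) (r (n - 1)) := by
    funext i
    have h1 := foldInt_nonneg hn' i
    have h2 := foldInt_emod_two n i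
    rw [foldInt_of_ge (by omega) (by omega), add_sub_cancel_right, h2, checker]
    split_ifs with h
    · simp [h]
    · rw [show i % 2 = 1 by omega]
  refine ⟨r n, r (n - 1), G.symm _ _ (by simpa using hr (n - 1)), ?_⟩
  have := hreach n
  simp only [h0] at this
  rwa [hfin] at this

/-! ### Moves between walks with fixed ends -/

/-- `HalfMove G x x' s s' z`: the words `x s` and `x' s'` are walks of the same length ending
at `z`, and each letter of the second one is adjacent to the letter of the first one which
follows the same position. -/
inductive HalfMove (G : LoopGraph V) : V → V → List V → List V → V → Prop
  | nil (x : V) : HalfMove G x x [] [] x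
  | cons {x x' y y' z : V} {s s' : List V} : G.Adj x y → G.Adj x' y' → G.Adj x' y →
      HalfMove G y y' s s' z → HalfMove G x x' (y :: s) (y' :: s') z

theorem HalfMove.left {x x' z : V} {s s' : List V} (h : HalfMove G x x' s s' z) : Wk G x s z := by
  induction h with
  | nil x => exact .nil x
  | cons h1 _ _ _ ih => exact .cons h1 ih

theorem HalfMove.right {x x' z : V} {s s' : List V} (h : HalfMove G x x' s s' z) :
    Wk G x' s' z := by
  induction h with
  | nil x => exact .nil x
  | cons _ h1 _ _ ih => exact .cons h1 ih

theorem HalfMove.length_eq {x x' z : V} {s s' : List V} (h : HalfMove G x x' s s' z) :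
    s.length = s'.length := by
  induction h with
  | nil x => rfl
  | cons _ _ _ _ ih => simp [ih]

theorem HalfMove.refl {x z : V} {s : List V} (h : Wk G x s z) : HalfMove G x x s s z := by
  induction h with
  | nil x => exact .nil x
  | cons h1 _ ih => exact .cons h1 h1 h1 ih

theorem HalfMove.append {x x' y z : V} {s s' t t' : List V} (h : HalfMove G x x' s s' y)
    (h' : HalfMove G y y t t' z) : HalfMove G x x' (s ++ t) (s' ++ t') z := by
  induction h with
  | nil x => exact h'
  | cons h1 h2 h3 _ ih => exact .cons h1 h2 h3 (ih h')

/-- Moves between walks with fixed ends. -/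
def Move (G : LoopGraph V) (x : V) (s s' : List V) (z : V) : Prop :=
  ∃ s'', HalfMove G x x s s'' z ∧ HalfMove G x x s' s'' z

/-- `Reach G t x s s' z`: the walks `x s` and `x s'` from `x` to `z` are related by `t` moves. -/
inductive Reach (G : LoopGraph V) : ℕ → V → List V → List V → V → Prop
  | refl {x z : V} {s : List V} : Wk G x s z → Reach G 0 x s s z
  | step {t : ℕ} {x z : V} {s s' s'' : List V} : Move G x s s' z → Reach G t x s' s'' z →
      Reach G (t + 1) x s s'' z

theorem HalfMove.reach {x z : V} {s s' : List V} (h : HalfMove G x x s s' z) :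
    Reach G 1 x s s' z :=
  .step ⟨s', h, .refl h.right⟩ (.refl h.right)

namespace Reach
variable {t t' : ℕ} {x y z : V} {s s' s'' u u' : List V}

theorem left (h : Reach G t x s s' z) : Wk G x s z := by
  cases h with
  | refl h => exact h
  | step h _ => exact h.choose_spec.1.left

theorem right (h : Reach G t x s s' z) : Wk G x s' z := by
  induction h <;> assumption

theorem length_eq (h : Reach G t x s s' z) : s.length = s'.length := by
  induction h with
  | refl _ => rfl
  | step h _ ih => rw [h.choose_spec.1.length_eq, ← h.choose_spec.2.length_eq, ih]

theorem trans (h : Reach G t x s s' z) (h' : Reach G t' x s' s'' z) :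
    Reach G (t + t') x s s'' z := by
  induction h with
  | refl _ => simpa using h'
  | step hm _ ih => rw [Nat.add_right_comm]; exact .step hm (ih h')

theorem symm (h : Reach G t x s s' z) : Reach G t x s' s z := by
  induction h with
  | refl h => exact .refl h
  | step hm h ih =>
    obtain ⟨v, h1, h2⟩ := hm
    exact ih.trans (.step ⟨v, h2, h1⟩ (.refl h1.left))

theorem mono (h : Reach G t x s s' z) (ht : t ≤ t') : Reach G t' x s s' z := by
  obtain ⟨d, rfl⟩ := Nat.exists_eq_add_of_le ht
  clear ht
  induction d with
  | zero => exact h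
  | succ d ih =>
    exact .step ⟨s, .refl h.left, .refl h.left⟩ ih

theorem append (h : Reach G t x s s' y) (h' : Reach G t y u u' z) :
    Reach G t x (s ++ u) (s' ++ u') z := by
  induction h generalizing u with
  | refl h => cases h' with | refl h' => exact .refl (h.append h')
  | step hm _ ih =>
    cases h' with
    | step hm' h' =>
      obtain ⟨v, h1, h2⟩ := hm
      obtain ⟨v', h1', h2'⟩ := hm'
      exact .step ⟨v ++ v', h1.append h1', h2.append h2'⟩ (ih h')

theorem append_left (h : Wk G x s y) (h' : Reach G t y u u' z) :
    Reach G t x (s ++ u) (s ++ u') z :=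
  append (mono (refl h) (Nat.zero_le _)) h'

theorem append_right (h : Reach G t x s s' y) (h' : Wk G y u z) :
    Reach G t x (s ++ u) (s' ++ u) z :=
  append h (mono (refl h') (Nat.zero_le _))

end Reach

theorem flip_halfMove {x b b' y : V} (h1 : G.Adj x b) (h2 : G.Adj b y) (h3 : G.Adj x b')
    (h4 : G.Adj b' y) : HalfMove G x x [b, y] [b', y] y :=
  .cons h1 h3 h1 (.cons h2 h4 h4 (.nil y))

/-- The letters of `v` advance by two positions, so the new letter at a position is the old one two
places later, hence a neighbour of the old one at the next position. A backtrack thus crosses all of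
`v` in one half-move, whatever the length of `v`. -/
theorem shift_halfMove {x y z b : V} {v : List V} (h : G.Adj x b) (hv : Wk G x v z)
    (hz : G.Adj z y) : HalfMove G x x (b :: x :: v) (v ++ [y, z]) z := by
  have aux : ∀ c₀ c₁ c₂ : V, G.Adj c₀ c₁ → G.Adj c₂ c₁ → Wk G c₂ v z →
      HalfMove G c₀ c₂ (c₁ :: c₂ :: v) (v ++ [y, z]) z := by
    clear h hv
    intro c₀ c₁ c₂ h1 h2 hv
    revert c₀ c₁
    induction hv with
    | nil c =>
      intro c₀ c₁ h1 h2
      exact .cons h1 hz h2 (.cons (G.symm _ _ h2) (G.symm _ _ hz) (G.symm _ _ hz) (.nil _))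
    | cons ha _ ih =>
      intro c₀ c₁ h1 h2
      exact .cons h1 ha h2 (ih hz _ _ (G.symm _ _ h2) (G.symm _ _ ha))
  exact aux x b x h h hv

/-! ### Zigzags -/

/-- The word `b a b a … b a`, of length `2 k`. -/
def zig (a b : V) : ℕ → List V
  | 0 => []
  | k + 1 => b :: a :: zig a b k

theorem zig_length (a b : V) (k : ℕ) : (zig a b k).length = 2 * k := by
  induction k with
  | zero => rfl
  | succ k ih => simp only [zig, List.length_cons, ih]; ring

theorem zig_add (a b : V) (k l : ℕ) : zig a b (k + l) = zig a b k ++ zig a b l := by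
  induction k with
  | zero => simp [zig]
  | succ k ih => rw [Nat.add_right_comm]; simp [zig, ih]

theorem zig_walk {a b : V} (h : G.Adj a b) (k : ℕ) : Wk G a (zig a b k) a := by
  induction k with
  | zero => exact .nil a
  | succ k ih => exact .cons h (.cons (G.symm _ _ h) ih)

theorem cons_zig_append (a b : V) (k : ℕ) : b :: (zig b a k ++ [a]) = zig a b (k + 1) := by
  induction k with
  | zero => rfl
  | succ k ih =>
    rw [zig, zig, List.cons_append, List.cons_append, ih]

theorem zig_change {a b c : V} (h : G.Adj a b) (h' : G.Adj a c) (k : ℕ) :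
    Reach G 1 a (zig a b k) (zig a c k) a := by
  refine HalfMove.reach ?_
  induction k with
  | zero => exact .nil a
  | succ k ih =>
    exact (flip_halfMove h (G.symm _ _ h) h' (G.symm _ _ h')).append ih

/-- The cost is the number of oscillations and does not depend on `v`. The logarithmic bound rests
on this. -/
theorem zig_shift {x b y z : V} {v : List V} (h : G.Adj x b) (hv : Wk G x v z)
    (hz : G.Adj z y) (k : ℕ) : Reach G k x (zig x b k ++ v) (v ++ zig z y k) z := by
  induction k with
  | zero => simpa [zig] using Reach.refl hv
  | succ k ih =>
    have h1 := (shift_halfMove h ((zig_walk h k).append hv) hz).reach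
    have h2 := ih.append_right (zig_walk hz 1)
    have h3 := h1.trans h2
    rw [List.append_assoc, ← zig_add, add_comm] at h3
    exact h3

/-! ### Reversed walks -/

/-- The word such that `z (back x s)` is the walk `x s` reversed, where `z` is the end of
`x s`. -/
def back : V → List V → List V
  | _, [] => []
  | x, y :: s => back y s ++ [x]

theorem back_length (x : V) (s : List V) : (back x s).length = s.length := by
  induction s generalizing x with
  | nil => rfl
  | cons y s ih => simp [back, ih]

theorem Wk.back {x z : V} {s : List V} (h : Wk G x s z) : Wk G z (back x s) x := by
  induction h with
  | nil x => exact .nil x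
  | cons h _ ih => exact ih.append (.single (G.symm _ _ h))

theorem Wk.back_append {x y : V} {s : List V} (h : Wk G x s y) (t : List V) :
    HomShift.back x (s ++ t) = HomShift.back y t ++ HomShift.back x s := by
  induction h with
  | nil x => simp [HomShift.back]
  | cons _ _ ih => simp [HomShift.back, ih]

theorem Wk.back_back {x z : V} {s : List V} (h : Wk G x s z) :
    HomShift.back z (HomShift.back x s) = s := by
  induction h with
  | nil x => rfl
  | cons _ h ih => rw [HomShift.back, h.back.back_append, ih]; rfl

theorem back_zig {a b : V} (h : G.Adj a b) (k : ℕ) : back a (zig a b k) = zig a b k := by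
  induction k with
  | zero => rfl
  | succ k ih =>
    have : zig a b (k + 1) = zig a b 1 ++ zig a b k := by rw [← zig_add, add_comm]
    rw [this, (zig_walk h 1).back_append, ih, show back a (zig a b 1) = zig a b 1 from rfl,
      ← zig_add, ← zig_add, add_comm]

/-- A walk followed by the reversed walk can be turned into a zigzag. -/
theorem Wk.collapse {x z b : V} {s : List V} (h : Wk G x s z) (hb : G.Adj x b) :
    Reach G s.length x (s ++ HomShift.back x s) (zig x b s.length) x := by
  induction h generalizing b with
  | nil x => exact .refl (.nil x)
  | @cons x y z s ha h ih =>
    have h1 := ih (G.symm _ _ ha)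
    have h2 := (Reach.append_left (.single ha) h1).append_right (.single (G.symm _ _ ha))
    have e : [y] ++ zig y x s.length ++ [x] = zig x y (s.length + 1) :=
      cons_zig_append x y s.length
    rw [e] at h2
    have h3 := h2.trans (zig_change ha hb _)
    simpa [HomShift.back] using h3

/-! ### From words to rows -/

/-- The row which reads the word `l` between the positions `c` and `c + n`, folded. -/
def rowOf (d : V) (c n : ℕ) (l : List V) (i : ℤ) : V := l.getD (c + (foldInt n i).toNat) d

theorem Wk.adj_getD {x z : V} {s : List V} (h : Wk G x s z) (d : V) {i : ℕ} (hi : i < s.length) :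
    G.Adj ((x :: s).getD i d) ((x :: s).getD (i + 1) d) := by
  induction h generalizing i with
  | nil x => simp at hi
  | cons ha _ ih =>
    cases i with
    | zero => simpa using ha
    | succ i => simpa using ih (by simpa using hi)

theorem rowOf_walk (d : V) {c n : ℕ} {l : List V} (hn : 1 ≤ n)
    (h : ∀ i, i < c + n → G.Adj (l.getD i d) (l.getD (i + 1) d)) : RowWalk G (rowOf d c n l) := by
  refine rowWalk_fold (by exact_mod_cast hn) (r := fun i : ℤ => l.getD (c + i.toNat) d)
    fun i h0 hi => ?_
  have := h (c + i.toNat) (by omega)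
  rwa [show c + i.toNat + 1 = c + (i + 1).toNat by omega] at this

theorem rowOf_adj (d : V) {c n : ℕ} {l l' : List V} (hn : 1 ≤ n)
    (h : ∀ i, i ≤ c + n → G.Adj (l.getD i d) (l'.getD i d)) (i : ℤ) :
    G.Adj (rowOf d c n l i) (rowOf d c n l' i) := by
  have := foldInt_le (n := n) (by exact_mod_cast hn) i
  exact h _ (by omega)

theorem HalfMove.adj_getD {x x' y z : V} {s s' : List V} (h : HalfMove G x x' s s' z)
    (hy : G.Adj z y) (d : V) {i : ℕ} (hi : i ≤ s.length) :
    G.Adj ((s ++ [y]).getD i d) ((x' :: s').getD i d) := by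
  induction h generalizing i with
  | nil x =>
    obtain rfl : i = 0 := by simpa using hi
    simpa using G.symm _ _ hy
  | cons _ _ h3 _ ih =>
    cases i with
    | zero => simpa using G.symm _ _ h3
    | succ i => simpa using ih hy (by simpa using hi)

theorem Wk.exists_adj {x z : V} {s : List V} (h : Wk G x s z) (hs : s ≠ []) :
    ∃ y, G.Adj z y := by
  induction h with
  | nil x => exact absurd rfl hs
  | @cons x y z s ha h ih =>
    cases h with
    | nil _ => exact ⟨_, G.symm _ _ ha⟩
    | cons _ _ => exact ih (by simp)

/-- The intermediate row is the first walk advanced by one letter, with a neighbour of `z` appended.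
It is adjacent to the first walk because that is a walk, and to the second one by the half-move
condition. -/
theorem HalfMove.rowReach {x z : V} {s s' : List V} (h : HalfMove G x x s s' z) (d : V)
    {c n : ℕ} (hn : 1 ≤ n) (hs : c + n ≤ s.length) :
    RowReach G 2 (rowOf d c n (x :: s)) (rowOf d c n (x :: s')) := by
  obtain ⟨y, hy⟩ := h.left.exists_adj (by rintro rfl; simp at hs; omega)
  have hlong := h.left.append (.single hy)
  have hs' := h.length_eq
  refine .step (rowOf_walk d hn fun i hi => h.left.adj_getD d (by omega))
    (r' := rowOf d c n (s ++ [y])) (rowOf_adj d hn fun i hi => ?_)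
    (.step (rowOf_walk d hn fun i hi => ?_)
      (rowOf_adj d hn fun i hi => h.adj_getD hy d (by omega))
      (.refl (rowOf_walk d hn fun i hi => h.right.adj_getD d (by omega))))
  · have := hlong.adj_getD d (i := i) (by simp; omega)
    rw [← List.cons_append, List.getD_append _ _ _ _ (by simp; omega)] at this
    simpa using this
  · simpa using hlong.adj_getD d (i := i + 1) (by simp; omega)

/-- A move consists of two half-moves, each costing two rows, whence the factor 4. -/
theorem Reach.rowReach {t : ℕ} {x z : V} {s s' : List V} (h : Reach G t x s s' z) (d : V)
    {c n : ℕ} (hn : 1 ≤ n) (hs : c + n ≤ s.length) :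
    RowReach G (4 * t) (rowOf d c n (x :: s)) (rowOf d c n (x :: s')) := by
  induction h with
  | refl h => exact .refl (rowOf_walk d hn fun i hi => h.adj_getD d (by omega))
  | step hm h ih =>
    obtain ⟨v, h1, h2⟩ := hm
    have e1 := h1.length_eq
    have e2 := h2.length_eq
    have := ((h1.rowReach d hn hs).trans (h2.rowReach d hn (by omega)).symm).trans
      (ih (by omega))
    rwa [show 4 * (_ + 1) = 2 + 2 + 4 * _ by ring]

theorem Wk.getD_append {x y : V} {s : List V} (h : Wk G x s y) (t : List V) (d : V) (j : ℕ) :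
    (x :: (s ++ t)).getD (s.length + j) d = (y :: t).getD j d := by
  induction h with
  | nil x => simp
  | cons _ _ ih =>
    rw [List.length_cons, Nat.add_right_comm, List.cons_append, List.getD_cons_succ, ih]

theorem zig_getD (a b d : V) (t : List V) {k j : ℕ} (hj : j ≤ 2 * k) :
    (a :: (zig a b k ++ t)).getD j d = if j % 2 = 0 then a else b := by
  induction k generalizing j with
  | zero =>
    obtain rfl : j = 0 := by omega
    simp
  | succ k ih =>
    match j with
    | 0 => simp
    | 1 => simp [zig]
    | j + 2 =>
      have := ih (j := j) (by omega)
      simp only [zig, List.cons_append, List.getD_cons_succ, Nat.add_mod_right]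
      exact this

/-! ### Contracting walks in logarithmic time -/

/-- A set of walks from `a` of bounded length, one of which ends at each vertex, such that a
zigzag followed by such a walk can absorb any further letter in bounded time. -/
structure Absorber (G : LoopGraph V) (a a' : V) where
  /-- The set of walks. -/
  words : Set (List V)
  /-- The walk that results from absorbing a letter. -/
  absorb : List V → V → List V
  /-- The number of oscillations needed to absorb a letter. -/
  reserve : ℕ
  /-- A bound on the length of the walks. -/
  bound : ℕ
  /-- The time needed to absorb a letter. -/
  time : ℕ
  adj : G.Adj a a'
  length_le : ∀ s ∈ words, s.length ≤ bound
  exists_word : ∀ x, ∃ s ∈ words, Wk G a s x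
  absorb_mem : ∀ s ∈ words, ∀ x y, Wk G a s x → G.Adj x y → absorb s y ∈ words
  reach : ∀ s ∈ words, ∀ x y, Wk G a s x → G.Adj x y →
    ∃ j, Reach G time a (zig a a' reserve ++ (s ++ [y])) (zig a a' j ++ absorb s y) y

theorem Wk.of_zig_append {a b z : V} (h : G.Adj a b) {k : ℕ} {s : List V}
    (hs : Wk G a (zig a b k ++ s) z) : Wk G a s z := by
  obtain ⟨y, h1, h2⟩ := hs.unappend
  rwa [h1.end_unique (zig_walk h k)] at h2

namespace Absorber
variable {a a' : V} (A : Absorber G a a')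
include A

theorem absorb_word {s w : List V} {x z : V} (hs : s ∈ A.words) (hx : Wk G a s x)
    (hw : Wk G x w z) {i : ℕ} (hi : 2 * A.reserve + A.bound ≤ 2 * i + s.length) :
    w.foldl A.absorb s ∈ A.words ∧ Wk G a (w.foldl A.absorb s) z ∧
      ∃ j, Reach G (A.time * w.length) a (zig a a' i ++ (s ++ w))
        (zig a a' j ++ w.foldl A.absorb s) z := by
  induction hw generalizing s i with
  | nil x => exact ⟨hs, hx, i, by simpa using Reach.refl ((zig_walk A.adj i).append hx)⟩
  | @cons x y z w ha hw ih =>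
    have hsl := A.length_le s hs
    obtain ⟨j, hj⟩ := A.reach s hs x y hx ha
    -- A word of the absorber has at most `bound` letters, so `hi` guarantees `reserve`
    -- oscillations. The hypothesis passes to the next letter because moves preserve the total
    -- length.
    obtain ⟨e, rfl⟩ := Nat.exists_eq_add_of_le' (show A.reserve ≤ i by omega)
    have h1 := hj.append_left (zig_walk A.adj e)
    rw [← List.append_assoc, ← zig_add, ← List.append_assoc (zig a a' e), ← zig_add] at h1
    have hl := h1.length_eq
    simp only [List.length_append, zig_length, List.length_cons, List.length_nil] at hl
    obtain ⟨h2, h3, j', h4⟩ := ih (A.absorb_mem s hs x y hx ha) (Wk.of_zig_append A.adj hj.right)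
      (i := e + j) (by omega)
    refine ⟨h2, h3, j', ?_⟩
    have h5 := (h1.append_right hw).trans (by simpa [List.append_assoc] using h4)
    simpa [List.append_assoc, Nat.mul_add, add_comm] using h5

/-- The number of oscillations kept in reserve. -/
def stock : ℕ := A.reserve + A.bound

/-- The number of letters absorbed before a walk is cut into two halves. -/
def chunk : ℕ := 2 * (3 * A.stock + 2 * A.bound) + 1

/-- The time needed to absorb a chunk, carry oscillations to the midpoint and turn them into a
word of the absorber followed by the reversed word. -/
def period : ℕ := A.time * A.chunk + 2 * (2 * A.stock + A.bound) + A.bound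

/-- Divide and conquer on the loop that follows `s`, then `w`, then returns along the word into
which `w` has been absorbed. A short `w` is absorbed outright, and the result collapses against the
return path. A long `w` first yields a chunk of oscillations, which pay for a detour to `a` at the
midpoint; this cuts the loop into two loops of the same form, with `k` smaller by one. -/
theorem contract (k : ℕ) {s w : List V} {x z : V} (hs : s ∈ A.words) (hx : Wk G a s x)
    (hw : Wk G x w z) (hk : w.length ≤ A.chunk * 2 ^ k) {i : ℕ} (hi : A.stock ≤ i) (i' : ℕ) :
    ∃ M, Reach G (A.period * (k + 1)) a
      (zig a a' i ++ (s ++ (w ++ back a (zig a a' i' ++ w.foldl A.absorb s)))) (zig a a' M) a := by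
  have hadj := A.adj
  have base : ∀ {s w : List V} {x z : V} (_ : s ∈ A.words) (_ : Wk G a s x)
      (_ : Wk G x w z) (_ : w.length ≤ A.chunk) {i : ℕ} (_ : A.stock ≤ i) (i' : ℕ),
      ∃ M, Reach G A.period a
        (zig a a' i ++ (s ++ (w ++ back a (zig a a' i' ++ w.foldl A.absorb s))))
        (zig a a' M) a := by
    intro s w x z hs hx hw hk i hi i'
    obtain ⟨h1, h2, j, h3⟩ := A.absorb_word hs hx hw (i := i) (by unfold stock at hi; omega)
    have h4 := h3.append_right h2.back
    have h5 := (h2.collapse hadj).append_left (zig_walk hadj j)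
    have h6 := h4.trans (by simpa [List.append_assoc] using h5)
    have h7 := h6.append_right (zig_walk hadj i')
    rw [← zig_add, ← zig_add] at h7
    refine ⟨j + (w.foldl A.absorb s).length + i',
      Reach.mono (t := A.time * w.length + (w.foldl A.absorb s).length) ?_ ?_⟩
    · rw [(zig_walk hadj i').back_append, back_zig hadj]
      simpa [List.append_assoc] using h7
    · have := A.length_le _ h1
      have := Nat.mul_le_mul_left A.time hk
      unfold period; omega
  induction k generalizing s w x z i i' with
  | zero => simpa using base hs hx hw (by simpa using hk) hi i'
  | succ k ih =>
    by_cases hsmall : w.length ≤ A.chunk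
    · obtain ⟨M, hM⟩ := base hs hx hw hsmall hi i'
      exact ⟨M, hM.mono (Nat.le_mul_of_pos_right _ (by omega))⟩
    have hB : A.chunk ≤ A.chunk * 2 ^ k := Nat.le_mul_of_pos_right _ (by positivity)
    have hk' : w.length ≤ A.chunk * 2 ^ k + A.chunk * 2 ^ k := by
      rw [pow_succ] at hk; linarith
    set H := A.chunk * 2 ^ k
    obtain ⟨u, w₁, w₂, rfl, hul, hwl, hw₂⟩ : ∃ u w₁ w₂, w = u ++ (w₁ ++ w₂) ∧
        u.length = A.chunk ∧ w₁.length ≤ H ∧ w₂.length ≤ H := by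
      refine ⟨w.take A.chunk, (w.drop A.chunk).take (H - A.chunk),
        (w.drop A.chunk).drop (H - A.chunk), by simp, by simp; omega, by simp,
        by simp; omega⟩
    obtain ⟨x₁, hu, hw'⟩ := hw.unappend
    obtain ⟨m, hw₁, hw₂'⟩ := hw'.unappend
    obtain ⟨hs₁, hx₁, j, hj⟩ := A.absorb_word hs hx hu (i := i) (by unfold stock at hi; omega)
    set s₁ := u.foldl A.absorb s with hs₁def
    have hlen := hj.length_eq
    have hs₁l := A.length_le _ hs₁
    simp only [List.length_append, zig_length, hul] at hlen
    -- The absorbed chunk has become oscillations: at most `2 * A.stock + A.bound` of them are spent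
    -- on the detour `em`, and at least `A.stock` remain for the first half.
    have hjs : 3 * A.stock + A.bound ≤ j := by
      unfold chunk at hlen; omega
    obtain ⟨hsm, hxm, -⟩ := A.absorb_word hs₁ hx₁ hw₁ (i := A.stock) (by unfold stock; omega)
    set sm := w₁.foldl A.absorb s₁ with hsmdef
    have hsml := A.length_le _ hsm
    -- The zigzag inside `em` is the initial stock of the second half; read backwards, it ends the
    -- first half.
    set em := zig a a' A.stock ++ sm with hemdef
    have hem : Wk G a em m := (zig_walk hadj _).append hxm
    have heml : em.length ≤ 2 * A.stock + A.bound := by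
      simp only [hemdef, List.length_append, zig_length]; omega
    obtain ⟨e, rfl⟩ := Nat.exists_eq_add_of_le (show em.length ≤ j by omega)
    obtain ⟨y, hy⟩ : ∃ y, G.Adj m y := by
      cases hw₂' with
      | nil _ =>
        have : u ++ w₁ ≠ [] := by
          have : 0 < u.length := by rw [hul]; unfold chunk; omega
          intro h; simp only [List.append_eq_nil_iff] at h; simp [h.1] at this
        exact (hu.append hw₁).exists_adj this
      | cons h _ => exact ⟨_, h⟩
    -- absorb a chunk, carry oscillations to the midpoint and turn them into `back a em ++ em`
    have h1 := hj.append_right hw₁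
    have h2 := zig_shift hadj (((zig_walk hadj e).append hx₁).append hw₁) hy em.length
    have h3 : Reach G em.length m (zig m y em.length) (back a em ++ em) m := by
      have := hem.back.collapse hy
      rw [hem.back_back, back_length] at this
      exact this.symm
    have h4 := h3.append_left (((zig_walk hadj e).append hx₁).append hw₁)
    have h5 := (h1.trans (by simpa [zig_add, List.append_assoc] using h2)).trans h4
    obtain ⟨M₁, hM₁⟩ := ih hs₁ hx₁ hw₁ hwl (i := e) (by omega) A.stock
    obtain ⟨M₂, hM₂⟩ := ih hsm hxm hw₂' hw₂ (i := A.stock) le_rfl i'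
    have hfold : (u ++ (w₁ ++ w₂)).foldl A.absorb s = w₂.foldl A.absorb sm := by
      simp [List.foldl_append, hs₁def, hsmdef]
    have hend : Wk G m (w₂ ++ back a (zig a a' i' ++ w₂.foldl A.absorb sm)) a := by
      obtain ⟨-, h, -⟩ := A.absorb_word hsm hxm hw₂' (i := A.stock) (by unfold stock; omega)
      exact hw₂'.append ((zig_walk hadj i').append h).back
    have h6 := h5.append_right hend
    -- Both halves contract during the same moves, so a halving costs one extra period instead of
    -- doubling the time.
    have h7 := hM₁.append hM₂
    rw [← zig_add] at h7
    refine ⟨M₁ + M₂, ?_⟩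
    rw [hfold]
    refine Reach.mono (t := A.time * u.length + em.length + em.length + A.period * (k + 1)) ?_ ?_
    · have := h6.trans (by simpa [hemdef, List.append_assoc] using h7)
      simpa [List.append_assoc] using this
    · have : A.time * A.chunk + em.length + em.length ≤ A.period := by unfold period; omega
      rw [hul, Nat.mul_succ A.period (k + 1)]
      omega

/-- The row is a window in a longer walk with zigzags at both ends. These unfold into detours to
`a`, after which the middle part is a loop at `a` to which `contract` applies. -/
theorem unwinds (k : ℕ) {n : ℕ} (hn : 1 ≤ n) (hk : n ≤ A.chunk * 2 ^ k) :
    Unwinds G n (4 * (A.period * (k + 2))) := by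
  intro r hr
  have hadj := A.adj
  have hw : ∀ m : ℕ, Wk G (r 0) ((List.range m).map fun i : ℕ => r (i + 1)) (r m) := by
    intro m
    induction m with
    | zero => exact .nil _
    | succ m ih =>
      rw [List.range_succ, List.map_append]
      refine ih.append (.single ?_)
      push_cast
      exact hr m
  have hw := hw n
  set w := (List.range n).map fun i : ℕ => r (i + 1) with hwdef
  have hwl : w.length = n := by simp [hwdef]
  have hx : G.Adj (r 0) (r 1) := by simpa using hr 0
  have hz : G.Adj (r n) (r (n - 1)) := G.symm _ _ (by simpa using hr (n - 1))
  obtain ⟨s, hs, hsx⟩ := A.exists_word (r 0)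
  have hsl := A.length_le _ hs
  obtain ⟨hs', hsz, -⟩ := A.absorb_word hs hsx hw (i := A.stock) (by unfold stock; omega)
  have hsl' := A.length_le _ hs'
  set e := zig a a' A.stock ++ s with hedef
  set e' := zig a a' A.stock ++ w.foldl A.absorb s with hedef'
  have he : Wk G a e (r 0) := (zig_walk hadj _).append hsx
  have he' : Wk G a e' (r n) := (zig_walk hadj _).append hsz
  have hel : e.length ≤ 2 * A.stock + A.bound := by
    simp only [hedef, List.length_append, zig_length]; omega
  have hel' : e'.length ≤ 2 * A.stock + A.bound := by
    simp only [hedef', List.length_append, zig_length]; omega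
  have key : ∀ {e : List V} {x y : V}, Wk G a e x → G.Adj x y →
      e.length ≤ 2 * A.stock + A.bound →
      Reach G A.period x (zig x y e.length) (back a e ++ e) x := by
    intro e x y he hxy hel
    have := he.back.collapse hxy
    rw [he.back_back, back_length] at this
    exact this.symm.mono (by unfold period; omega)
  obtain ⟨M, hM⟩ := A.contract k hs hsx hw (by omega) le_rfl A.stock
  have h1 := (key he hx hel).append ((Reach.append_left hw (key he' hz hel')))
  have h2 := (hM.append_left he.back).append_right he'
  have h3 : Reach G (A.period + A.period * (k + 1)) (r 0)
      (zig (r 0) (r 1) e.length ++ (w ++ zig (r n) (r (n - 1)) e'.length))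
      (back a e ++ zig a a' M ++ e') (r n) := by
    refine h1.trans ?_
    simpa only [hedef, hedef', List.append_assoc] using h2
  have hlen := h3.length_eq
  simp only [List.length_append, zig_length, back_length, hwl] at hlen
  have h4 := h3.rowReach (r 0) (c := 2 * e.length) hn (by
    simp only [List.length_append, zig_length, hwl]; omega)
  refine ⟨4 * (A.period + A.period * (k + 1)), le_of_eq (by ring), ?_⟩
  have hn' : (1 : ℤ) ≤ n := by exact_mod_cast hn
  have hstart : rowOf (r 0) (2 * e.length) n
      (r 0 :: (zig (r 0) (r 1) e.length ++ (w ++ zig (r n) (r (n - 1)) e'.length)))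
      = fun i => r (foldInt n i) := by
    funext i
    have h0 := foldInt_nonneg hn' i
    have h1 := foldInt_le hn' i
    rw [rowOf, ← zig_length (r 0) (r 1) e.length, (zig_walk hx _).getD_append]
    obtain ⟨m, hm⟩ := Int.eq_ofNat_of_zero_le h0
    rw [hm] at h1 ⊢
    simp only [Int.toNat_natCast]
    cases m with
    | zero => simp
    | succ m =>
      have hmn : m < n := by omega
      rw [List.getD_cons_succ, List.getD_append _ _ _ _ (by omega), hwdef]
      simp [hmn]
  -- Conservation of length: the window, from `2 * e.length` to `2 * e.length + n`, now lies inside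
  -- the zigzag, which extends from `e.length` to `e.length + 2 * M`.
  have hM' : n + 2 * e.length + 2 * e'.length = e.length + 2 * M + e'.length := by omega
  have hend : ∀ i, rowOf (r 0) (2 * e.length) n (r 0 :: (back a e ++ zig a a' M ++ e')) i =
      if ((e.length : ℤ) + i) % 2 = 0 then a else a' := by
    intro i
    have h0 := foldInt_nonneg hn' i
    have h1 := foldInt_le hn' i
    have h2 := foldInt_emod_two n i
    rw [rowOf, two_mul, add_assoc, List.append_assoc]
    have := he.back.getD_append (zig a a' M ++ e') (r 0) (e.length + (foldInt n i).toNat)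
    rw [back_length] at this
    rw [this, zig_getD _ _ _ _ (by omega)]
    exact if_congr (by omega) rfl rfl
  rw [hstart] at h4
  rcases Int.emod_two_eq_zero_or_one (e.length : ℤ) with hpar | hpar
  · refine ⟨a, a', hadj, ?_⟩
    convert h4 using 1
    funext i
    rw [hend, checker]
    exact if_congr (by omega) rfl rfl
  · refine ⟨a', a, G.symm _ _ hadj, ?_⟩
    convert h4 using 1
    funext i
    rw [hend, checker]
    split_ifs <;> first | rfl | omega

end Absorber

/-! ### Reduction of words -/

theorem nonBacktracking_short {p : List V} (h : p.length ≤ 2) : NonBacktracking p := by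
  intro a b hab
  have := hab.length_le
  simp at this
  omega

theorem nonBacktracking_cons {a b c : V} {t : List V} :
    NonBacktracking (a :: b :: c :: t) ↔ a ≠ c ∧ NonBacktracking (b :: c :: t) := by
  constructor
  · intro h
    refine ⟨?_, fun x y hxy => h x y (hxy.trans (List.suffix_cons _ _).isInfix)⟩
    rintro rfl
    exact h a b ⟨[], t, rfl⟩
  · rintro ⟨hac, h⟩ x y hxy
    rcases List.infix_cons_iff.1 hxy with hp | hp
    · simp only [List.cons_prefix_cons] at hp
      exact hac (hp.1.symm.trans hp.2.2.1)
    · exact h x y hp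

theorem NonBacktracking.of_append_left {l r : List V} (h : NonBacktracking (l ++ r)) :
    NonBacktracking l :=
  fun x y hxy => h x y (hxy.trans (List.prefix_append _ _).isInfix)

theorem NonBacktracking.of_append_right {l r : List V} (h : NonBacktracking (l ++ r)) :
    NonBacktracking r :=
  fun x y hxy => h x y (hxy.trans (List.suffix_append _ _).isInfix)

theorem NonBacktracking.reverse {p : List V} (h : NonBacktracking p) :
    NonBacktracking p.reverse := by
  intro x y hxy
  have := List.reverse_infix.2 hxy
  rw [List.reverse_reverse] at this
  exact h x y (by simpa using this)

open Classical in
/-- Adding a letter to a non-backtracking word, whose letters are listed from the last to the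
first. -/
noncomputable def push : List V → V → List V
  | b :: x :: t, v => if x = v then x :: t else v :: b :: x :: t
  | t, v => v :: t

theorem push_nonBacktracking {σ : List V} (h : NonBacktracking σ) (v : V) :
    NonBacktracking (push σ v) := by
  match σ with
  | [] => exact nonBacktracking_short (by simp [push])
  | [b] => exact nonBacktracking_short (by simp [push])
  | b :: x :: t =>
    rw [push]
    split_ifs with hx
    · exact h.of_append_right (l := [b])
    · exact nonBacktracking_cons.2 ⟨fun e => hx e.symm, h⟩

theorem push_head (σ : List V) (v : V) : ∃ t, push σ v = v :: t := by
  match σ with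
  | [] => exact ⟨[], rfl⟩
  | [b] => exact ⟨[b], rfl⟩
  | b :: x :: t =>
    rw [push]
    split_ifs with hx
    · exact ⟨t, by rw [hx]⟩
    · exact ⟨_, rfl⟩

/-- Either `b` is added and then cancelled, or `b` cancels `x`, which is then put back; in the
second case reducedness rules out a further cancellation. Invariance of `red` under spine removal,
hence uniqueness of reductions, comes from this. -/
theorem push_push {x : V} {t : List V} (h : NonBacktracking (x :: t)) (b : V) :
    push (push (x :: t) b) x = x :: t := by
  match t with
  | [] => simp [push]
  | c :: t =>
    by_cases hc : c = b
    · subst hc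
      match t with
      | [] => simp [push]
      | d :: t =>
        have hd : d ≠ x := (nonBacktracking_cons.1 h).1.symm
        simp [push, hd]
    · simp [push, hc]

/-- The reduction of a word. -/
noncomputable def red (p : List V) : List V := (p.foldl push []).reverse

theorem foldl_push_nonBacktracking {σ : List V} (h : NonBacktracking σ) (p : List V) :
    NonBacktracking (p.foldl push σ) := by
  induction p generalizing σ with
  | nil => exact h
  | cons v p ih => exact ih (push_nonBacktracking h v)

theorem red_nonBacktracking (p : List V) : NonBacktracking (red p) :=
  (foldl_push_nonBacktracking (nonBacktracking_short (by simp)) p).reverse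

theorem red_append_congr {p q : List V} (h : red p = red q) (r : List V) :
    red (p ++ r) = red (q ++ r) := by
  have := List.reverse_injective h
  simp only [red, List.foldl_append, this]

theorem SpineRemoval.append {p q : List V} (h : SpineRemoval p q) (r : List V) :
    SpineRemoval (p ++ r) (q ++ r) := by
  obtain ⟨l, r', a, b⟩ := h
  simpa [List.append_assoc] using SpineRemoval.intro l (r' ++ r) a b

theorem isReduction_red (p : List V) : IsReduction p (red p) := by
  refine ⟨?_, red_nonBacktracking p⟩
  induction p using List.reverseRecOn with
  | nil => exact .refl
  | append_singleton p v ih =>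
    have h1 : Relation.ReflTransGen SpineRemoval (p ++ [v]) (red p ++ [v]) :=
      ih.lift (· ++ [v]) fun _ _ h => h.append [v]
    refine h1.trans ?_
    simp only [red, List.foldl_append, List.foldl_cons, List.foldl_nil]
    match p.foldl push [] with
    | [] => exact .refl
    | [b] => exact .refl
    | b :: x :: t =>
      rw [push]
      split_ifs with hx
      · subst hx
        refine .single ?_
        simpa using SpineRemoval.intro t.reverse [] x b
      · simp only [List.reverse_cons]; exact .refl

theorem SpineRemoval.red_eq {p q : List V} (h : SpineRemoval p q) : red p = red q := by
  obtain ⟨l, r, a, b⟩ := h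
  refine red_append_congr ?_ r
  simp only [red, List.foldl_append, List.foldl_cons, List.foldl_nil]
  have hnb := foldl_push_nonBacktracking (nonBacktracking_short (by simp)) l (σ := [])
  obtain ⟨t, ht⟩ := push_head (l.foldl push []) a
  have := push_nonBacktracking hnb a
  rw [ht] at this ⊢
  rw [push_push this]

theorem red_eq_self {p : List V} (h : NonBacktracking p) : red p = p := by
  induction p using List.reverseRecOn with
  | nil => rfl
  | append_singleton p v ih =>
    have ih := ih h.of_append_left
    simp only [red, List.foldl_append, List.foldl_cons, List.foldl_nil] at ih ⊢
    rw [List.reverse_eq_iff] at ih ⊢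
    rw [ih]
    have h' := h.reverse
    simp only [List.reverse_append, List.reverse_singleton, List.singleton_append] at h' ⊢
    match hp : p.reverse with
    | [] => rfl
    | [b] => rfl
    | b :: x :: t =>
      rw [hp] at h'
      have := (nonBacktracking_cons.1 h').1
      rw [push, if_neg this.symm]

theorem red_red (p : List V) : red (red p) = red p := red_eq_self (red_nonBacktracking p)

theorem IsReduction.eq_red {p q : List V} (h : IsReduction p q) : q = red p := by
  have key : ∀ {q}, Relation.ReflTransGen SpineRemoval p q → red p = red q := by
    intro q hq
    induction hq with
    | refl => rfl
    | tail _ hs ih => exact ih.trans hs.red_eq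
  rw [key h.1, red_eq_self h.2]

/-! ### Walks as words -/

theorem isWalk_iff {p : List V} {a : V} : IsWalk G p ∧ p.head? = some a ↔
    ∃ s z, p = a :: s ∧ Wk G a s z := by
  constructor
  · rintro ⟨⟨hp, hc⟩, ha⟩
    match p with
    | [] => simp at ha
    | b :: s =>
      obtain rfl : b = a := by simpa using ha
      refine ⟨s, ?_⟩
      suffices ∃ z, Wk G b s z by obtain ⟨z, hz⟩ := this; exact ⟨z, rfl, hz⟩
      clear hp ha
      induction s generalizing b with
      | nil => exact ⟨b, .nil b⟩
      | cons y s ih =>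
        rw [List.isChain_cons_cons] at hc
        obtain ⟨z, hz⟩ := ih _ hc.2
        exact ⟨z, .cons hc.1 hz⟩
  · rintro ⟨s, z, rfl, h⟩
    refine ⟨⟨by simp, ?_⟩, rfl⟩
    induction h with
    | nil x => simp
    | cons ha _ ih => exact List.isChain_cons_cons.2 ⟨ha, ih⟩

theorem Wk.split {a x z : V} {s l r : List V} (h : Wk G a s z) (e : a :: s = l ++ x :: r) :
    ∃ l', l ++ [x] = a :: l' ∧ s = l' ++ r ∧ Wk G a l' x ∧ Wk G x r z := by
  match l with
  | [] =>
    simp only [List.nil_append, List.cons.injEq] at e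
    obtain ⟨rfl, rfl⟩ := e
    exact ⟨[], rfl, rfl, .nil _, h⟩
  | b :: l =>
    simp only [List.cons_append, List.cons.injEq] at e
    obtain ⟨rfl, rfl⟩ := e
    obtain ⟨y, h1, h2⟩ := h.unappend
    cases h2 with
    | cons h2 h3 =>
      exact ⟨l ++ [x], rfl, by simp, h1.append (.single h2), h3⟩

theorem isSquare_iff {s : List V} : IsSquare G s ↔ ∃ x b c d, s = [x, b, c, d, x] ∧ G.Adj x b ∧
    G.Adj b c ∧ G.Adj c d ∧ G.Adj d x ∧ x ≠ c ∧ b ≠ d := by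
  constructor
  · rintro ⟨⟨-, hc⟩, hn, hl, he⟩
    match s with
    | [x, b, c, d, y] =>
      obtain rfl : x = y := by simpa using he
      simp only [List.isChain_cons_cons] at hc
      rw [nonBacktracking_cons, nonBacktracking_cons] at hn
      exact ⟨x, b, c, d, rfl, hc.1, hc.2.1, hc.2.2.1, hc.2.2.2.1, hn.1, hn.2.1⟩
  · rintro ⟨x, b, c, d, rfl, h1, h2, h3, h4, h5, h6⟩
    refine ⟨⟨by simp, by simp [h1, h2, h3, h4]⟩, ?_, rfl, rfl⟩
    rw [nonBacktracking_cons, nonBacktracking_cons, nonBacktracking_cons]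
    exact ⟨h5, h6, h5.symm, nonBacktracking_short (by simp)⟩

theorem addsSquare_iff {p q : List V} : AddsSquare G p q ↔ ∃ l r x b c d, p = l ++ x :: r ∧
    IsSquare G [x, b, c, d, x] ∧ q = red (l ++ [x, b, c, d, x] ++ r) := by
  constructor
  · rintro ⟨k, s, hk, hs, he, hr⟩
    obtain ⟨x, b, c, d, rfl, -⟩ := isSquare_iff.1 hs
    rw [List.getElem?_eq_getElem hk] at he
    simp only [List.head?_cons, Option.some.injEq] at he
    refine ⟨p.take k, p.drop (k + 1), x, b, c, d, ?_, hs, hr.eq_red⟩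
    rw [he, List.getElem_cons_drop, List.take_append_drop]
  · rintro ⟨l, r, x, b, c, d, rfl, hs, rfl⟩
    refine ⟨l.length, _, by simp, hs, by simp, ?_⟩
    have : insertAt (l ++ x :: r) l.length [x, b, c, d, x] = l ++ [x, b, c, d, x] ++ r := by
      simp [insertAt]
    rw [this]
    exact isReduction_red _

/-! ### Homotopy of walks with oscillations added in front -/

/-- The walks `a s` and `a s'` to `z` are related by moves after adding zigzags in front of
them. -/
def StablyReach (G : LoopGraph V) (a a' : V) (s s' : List V) (z : V) : Prop :=
  ∃ i j t, Reach G t a (zig a a' i ++ s) (zig a a' j ++ s') z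

namespace StablyReach
variable {a a' x z : V} {s s' s'' : List V}

theorem refl (h : G.Adj a a') (hs : Wk G a s z) : StablyReach G a a' s s z :=
  ⟨0, 0, 0, .refl ((zig_walk h 0).append hs)⟩

theorem symm (h : StablyReach G a a' s s' z) : StablyReach G a a' s' s z := by
  obtain ⟨i, j, t, h⟩ := h
  exact ⟨j, i, t, h.symm⟩

theorem trans (ha : G.Adj a a') (h : StablyReach G a a' s s' z)
    (h' : StablyReach G a a' s' s'' z) : StablyReach G a a' s s'' z := by
  obtain ⟨i, j, t, h⟩ := h
  obtain ⟨k, l, t', h'⟩ := h'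
  have h1 := h.append_left (zig_walk ha k)
  have h2 := h'.append_left (zig_walk ha j)
  rw [← List.append_assoc, ← zig_add, ← List.append_assoc, ← zig_add] at h1 h2
  rw [add_comm k j] at h1
  exact ⟨_, _, _, h1.trans h2⟩

theorem append (h : StablyReach G a a' s s' x) {r : List V} (hr : Wk G x r z) :
    StablyReach G a a' (s ++ r) (s' ++ r) z := by
  obtain ⟨i, j, t, h⟩ := h
  exact ⟨i, j, t, by simpa [List.append_assoc] using h.append_right hr⟩

theorem left (ha : G.Adj a a') (h : StablyReach G a a' s s' z) : Wk G a s z := by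
  obtain ⟨i, j, t, h⟩ := h
  exact Wk.of_zig_append ha h.left

theorem right (ha : G.Adj a a') (h : StablyReach G a a' s s' z) : Wk G a s' z :=
  h.symm.left ha

theorem of_reach (h : Reach G t a s s' z) : StablyReach G a a' s s' z := ⟨0, 0, t, h⟩

end StablyReach

/-- The backtrack is carried to the front of the walk, where it counts as one more oscillation. -/
theorem stablyReach_spine {a a' x b z : V} {l r : List V} (ha : G.Adj a a') (hl : Wk G a l x)
    (hb : G.Adj x b) (hr : Wk G x r z) : StablyReach G a a' (l ++ [b, x] ++ r) (l ++ r) z := by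
  refine StablyReach.append ⟨0, 1, 1, ?_⟩ hr
  exact (zig_shift ha hl hb 1).symm

/-- Flipping the corner `d` to `b` turns the square into two nested backtracks. -/
theorem stablyReach_square {a a' x b c d z : V} {l r : List V} (ha : G.Adj a a')
    (hl : Wk G a l x) (hs : IsSquare G [x, b, c, d, x]) (hr : Wk G x r z) :
    StablyReach G a a' (l ++ [b, c, d, x] ++ r) (l ++ r) z := by
  obtain ⟨_, _, _, _, e, h1, h2, h3, h4, -⟩ := isSquare_iff.1 hs
  simp only [List.cons.injEq] at e
  obtain ⟨rfl, rfl, rfl, rfl, -⟩ := e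
  have hflip : Reach G 1 x ([b] ++ [c, d, x] ++ r) ([b] ++ [c, b, x] ++ r) z :=
    ((flip_halfMove h3 h4 (G.symm _ _ h2) (G.symm _ _ h1)).reach.append_left
      (s := [b, c]) (.cons h1 (.single h2))).append_right hr
  have h5 := StablyReach.of_reach (a' := a') (hflip.append_left hl)
  have h6 := stablyReach_spine ha (hl.append (.single h1)) h2
    (Wk.cons (G.symm _ _ h1) hr)
  have h7 := stablyReach_spine ha hl h1 hr
  have h8 := (StablyReach.trans ha (by simpa using h5) (by simpa using h6)).trans ha
    (by simpa using h7)
  simpa using h8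

theorem SpineRemoval.stablyReach {a a' z : V} {s q : List V} (ha : G.Adj a a')
    (h : SpineRemoval (a :: s) q) (hs : Wk G a s z) :
    ∃ s', q = a :: s' ∧ StablyReach G a a' s s' z := by
  generalize hp : a :: s = p at h
  obtain ⟨l, r, x, b⟩ := h
  obtain ⟨l', h1, rfl, h2, h3⟩ := hs.split (l := l) (x := x) (r := b :: x :: r) (by simpa using hp)
  cases h3 with
  | cons hb h3 =>
    cases h3 with
    | cons _ hr =>
      refine ⟨l' ++ r, by simp [h1], ?_⟩
      simpa using stablyReach_spine ha h2 hb hr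

theorem stablyReach_red {a a' z : V} {s : List V} (ha : G.Adj a a') (hs : Wk G a s z) :
    ∃ s', red (a :: s) = a :: s' ∧ StablyReach G a a' s s' z := by
  have h := (isReduction_red (a :: s)).1
  generalize red (a :: s) = q at h
  induction h with
  | refl => exact ⟨s, rfl, .refl ha hs⟩
  | tail _ h ih =>
    obtain ⟨s', rfl, h1⟩ := ih
    obtain ⟨s'', rfl, h2⟩ := h.stablyReach ha (h1.right ha)
    exact ⟨s'', rfl, h1.trans ha h2⟩

theorem AddsSquare.stablyReach {a a' z : V} {s q : List V} (ha : G.Adj a a')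
    (h : AddsSquare G (a :: s) q) (hs : Wk G a s z) :
    ∃ s', q = a :: s' ∧ StablyReach G a a' s s' z := by
  obtain ⟨l, r, x, b, c, d, e, hsq, rfl⟩ := addsSquare_iff.1 h
  obtain ⟨l', h1, rfl, h2, h3⟩ := hs.split e
  have h4 := stablyReach_square ha h2 hsq h3
  obtain ⟨s', h5, h6⟩ := stablyReach_red ha (h4.left ha)
  refine ⟨s', ?_, h4.symm.trans ha h6⟩
  rw [← h5]
  congr 1
  have : l ++ [x, b, c, d, x] ++ r = (l ++ [x]) ++ ([b, c, d, x] ++ r) := by simp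
  rw [this, h1]; simp

theorem UniversalCoverVertex.exists_walk {a : V} (p : UniversalCoverVertex G a) :
    ∃ s z, p.1 = a :: s ∧ Wk G a s z :=
  isWalk_iff.1 ⟨p.2.1, p.2.2.2⟩

theorem stablyReach_of_squareSetoid {a a' : V} (ha : G.Adj a a') {p q : UniversalCoverVertex G a}
    (h : squareSetoid G a p q) : ∃ s s' z, p.1 = a :: s ∧ q.1 = a :: s' ∧
      StablyReach G a a' s s' z := by
  have key : ∀ p q : UniversalCoverVertex G a, AddsSquare G p.1 q.1 → ∃ s s' z, p.1 = a :: s ∧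
      q.1 = a :: s' ∧ StablyReach G a a' s s' z := by
    intro p q h
    obtain ⟨s, z, hp, hs⟩ := p.exists_walk
    rw [hp] at h
    obtain ⟨s', hq, h'⟩ := h.stablyReach ha hs
    exact ⟨s, s', z, hp, hq, h'⟩
  have h' : Relation.EqvGen (fun p q : UniversalCoverVertex G a => DifferBySquare G p.1 q.1) p q := h
  clear h
  induction h' with
  | rel p q h =>
    rcases h with h | h
    · exact key p q h
    · obtain ⟨s, s', z, h1, h2, h3⟩ := key q p h
      exact ⟨s', s, z, h2, h1, h3.symm⟩
  | refl p =>
    obtain ⟨s, z, hp, hs⟩ := p.exists_walk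
    exact ⟨s, s, z, hp, hp, .refl ha hs⟩
  | symm p q _ ih =>
    obtain ⟨s, s', z, h1, h2, h3⟩ := ih
    exact ⟨s', s, z, h2, h1, h3.symm⟩
  | trans p q r _ _ ih ih' =>
    obtain ⟨s, s', z, h1, h2, h3⟩ := ih
    obtain ⟨t, t', z', h1', h2', h3'⟩ := ih'
    obtain rfl : s' = t := by simpa using h2.symm.trans h1'
    obtain rfl := (h3.right ha).end_unique (h3'.left ha)
    exact ⟨s, t', z, h1, h2', h3.trans ha h3'⟩

/-- The words are chosen representatives of the classes, and absorbing a letter means passing to the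
representative of the extended walk. There are finitely many pairs of a class and a letter, so the
oscillations and the time needed are bounded uniformly. -/
theorem exists_absorber [Finite V] (hG : G.Connected) {a a' : V} (ha : G.Adj a a')
    (hfin : (squareCover G a).IsFinite) : Nonempty (Absorber G a a') := by
  have : Finite (SquareCoverVertex G a) := hfin
  let word : SquareCoverVertex G a → List V := fun Q => (Quotient.out Q).1.tail
  have hword : ∀ Q, ∃ z, (Quotient.out Q).1 = a :: word Q ∧ Wk G a (word Q) z := by
    intro Q
    obtain ⟨s, z, h, hs⟩ := (Quotient.out Q).exists_walk
    exact ⟨z, by simp [word, h], by simpa [word, h] using hs⟩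
  have hred : ∀ s z, Wk G a s z → ∃ Q, StablyReach G a a' s (word Q) z := by
    intro s z hs
    obtain ⟨s', h1, h2⟩ := stablyReach_red ha hs
    have hw := isWalk_iff.2 ⟨s', z, rfl, h2.right ha⟩
    let p : UniversalCoverVertex G a :=
      ⟨a :: s', hw.1, h1 ▸ red_nonBacktracking _, hw.2⟩
    obtain ⟨t, t', z', h3, h4, h5⟩ := stablyReach_of_squareSetoid ha
      (Quotient.exact (Quotient.out_eq (Quotient.mk (squareSetoid G a) p)))
    obtain rfl : s' = t' := by simpa [p] using h4
    obtain rfl := (h2.right ha).end_unique (h5.right ha)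
    refine ⟨Quotient.mk (squareSetoid G a) p, ?_⟩
    obtain rfl : word (Quotient.mk (squareSetoid G a) p) = t := by simp only [word, h3]; rfl
    exact h2.trans ha h5.symm
  have hstep : ∀ (Q : SquareCoverVertex G a) (y : V), ∃ (Q' : SquareCoverVertex G a) (i j t : ℕ),
      ∀ x, Wk G a (word Q) x → G.Adj x y →
        Reach G t a (zig a a' i ++ (word Q ++ [y])) (zig a a' j ++ word Q') y := by
    intro Q y
    obtain ⟨x, -, hx⟩ := hword Q
    by_cases hxy : G.Adj x y
    · obtain ⟨Q', i, j, t, h⟩ := hred _ _ (hx.append (.single hxy))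
      exact ⟨Q', i, j, t, fun _ _ _ => h⟩
    · refine ⟨Q, 0, 0, 0, fun x' hx' h => ?_⟩
      rw [hx.end_unique hx'] at hxy
      exact absurd h hxy
  choose next i j t hnext using hstep
  obtain ⟨N, hN⟩ := Finite.exists_le fun Q : SquareCoverVertex G a × V => i Q.1 Q.2
  obtain ⟨T, hT⟩ := Finite.exists_le fun Q : SquareCoverVertex G a × V => t Q.1 Q.2
  obtain ⟨D, hD⟩ := Finite.exists_le fun Q : SquareCoverVertex G a => (word Q).length
  -- `absorb` acts on words rather than on classes, so a section of `word` is needed; off its range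
  -- the value is irrelevant.
  have hindex : ∀ s : List V, ∃ Q, s ∈ Set.range word → word Q = s := by
    intro s
    by_cases h : s ∈ Set.range word
    · obtain ⟨Q, h⟩ := h; exact ⟨Q, fun _ => h⟩
    · obtain ⟨Q, -⟩ := hred [] a (.nil a)
      exact ⟨Q, fun h' => absurd h' h⟩
  choose index hindex using hindex
  refine ⟨{ words := Set.range word, absorb := fun s y => word (next (index s) y), reserve := N,
            bound := D, time := T, adj := ha, length_le := ?_, exists_word := ?_,
            absorb_mem := fun _ _ _ _ _ _ => ⟨_, rfl⟩, reach := ?_ }⟩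
  · rintro _ ⟨Q, rfl⟩; exact hD Q
  · intro x
    suffices ∃ s, Wk G a s x by
      obtain ⟨s, hs⟩ := this
      obtain ⟨Q, h⟩ := hred s x hs
      exact ⟨_, ⟨Q, rfl⟩, h.right ha⟩
    induction hG.2 a x with
    | refl => exact ⟨[], .nil a⟩
    | tail _ h ih =>
      obtain ⟨s, hs⟩ := ih
      exact ⟨_, hs.append (.single h)⟩
  · intro s hs x y hx hxy
    have e := hindex s hs
    have h := hnext (index s) y x (by rwa [e]) hxy
    rw [e] at h
    obtain ⟨k, hk⟩ := Nat.exists_eq_add_of_le' (hN (index s, y))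
    dsimp only at hk
    refine ⟨k + j (index s) y, ?_⟩
    rw [hk, zig_add, zig_add, List.append_assoc, List.append_assoc]
    exact (h.append_left (zig_walk ha k)).mono (hT (index s, y))

/-! ### Homotopy of words -/

/-- The word `p` is a walk from `a` to `z`. -/
def EndsAt (G : LoopGraph V) (a : V) (p : List V) (z : V) : Prop := ∃ s, p = a :: s ∧ Wk G a s z

theorem EndsAt.unique {a z z' : V} {p : List V} (h : EndsAt G a p z) (h' : EndsAt G a p z') :
    z = z' := by
  obtain ⟨s, rfl, h⟩ := h
  obtain ⟨t, e, h'⟩ := h'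
  obtain rfl : s = t := by simpa using e
  exact h.end_unique h'

theorem EndsAt.append {a z z' : V} {p r : List V} (h : EndsAt G a p z) (hr : Wk G z r z') :
    EndsAt G a (p ++ r) z' := by
  obtain ⟨s, rfl, h⟩ := h
  exact ⟨s ++ r, rfl, h.append hr⟩

theorem EndsAt.split {a x z : V} {l r : List V} (h : EndsAt G a (l ++ x :: r) z) :
    EndsAt G a (l ++ [x]) x ∧ Wk G x r z := by
  obtain ⟨s, e, h⟩ := h
  obtain ⟨l', h1, rfl, h2, h3⟩ := h.split e.symm
  exact ⟨⟨l', h1, h2⟩, h3⟩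

theorem EndsAt.unappend {a z : V} {p r : List V} (hp : p ≠ []) (h : EndsAt G a (p ++ r) z) :
    ∃ y, EndsAt G a p y ∧ Wk G y r z := by
  obtain ⟨l, x, rfl⟩ := List.eq_nil_or_concat' p |>.resolve_left hp
  obtain ⟨h1, h2⟩ := EndsAt.split (l := l) (x := x) (r := r) (by simpa using h)
  exact ⟨x, h1, h2⟩

theorem EndsAt.exists_append {a z : V} {p : List V} (h : EndsAt G a p z) :
    ∃ l, p = l ++ [z] := by
  obtain ⟨s, rfl, h⟩ := h
  induction h with
  | nil x => exact ⟨[], rfl⟩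
  | @cons x y z s _ _ ih => obtain ⟨l, h⟩ := ih; exact ⟨x :: l, by rw [h]; rfl⟩

theorem SpineRemoval.endsAt {a z : V} {p q : List V} (h : SpineRemoval p q)
    (hp : EndsAt G a p z) : EndsAt G a q z := by
  obtain ⟨l, r, x, b⟩ := h
  obtain ⟨h1, h2⟩ := EndsAt.split (l := l) (x := x) (r := b :: x :: r) (by simpa using hp)
  cases h2 with
  | cons _ h2 => cases h2 with | cons _ h2 => exact h1.append h2

theorem EndsAt.red {a z : V} {p : List V} (hp : EndsAt G a p z) : EndsAt G a (red p) z := by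
  have := (isReduction_red p).1
  generalize HomShift.red p = q at this
  induction this with
  | refl => exact hp
  | tail _ h ih => exact h.endsAt ih

/-- Removal of a backtracking or of a square in a word. -/
inductive HomotopyStep (G : LoopGraph V) : List V → List V → Prop
  | spine (l r : List V) {x b : V} : G.Adj x b →
      HomotopyStep G (l ++ [x, b, x] ++ r) (l ++ [x] ++ r)
  | square (l r : List V) {x b c d : V} : IsSquare G [x, b, c, d, x] →
      HomotopyStep G (l ++ [x, b, c, d, x] ++ r) (l ++ [x] ++ r)

/-- The equivalence relation generated by `HomotopyStep`. -/
def Homotopic (G : LoopGraph V) (p q : List V) : Prop := Relation.EqvGen (HomotopyStep G) p q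

theorem Homotopic.refl (p : List V) : Homotopic G p p := Relation.EqvGen.refl p

theorem Homotopic.symm {p q : List V} (h : Homotopic G p q) : Homotopic G q p :=
  Relation.EqvGen.symm _ _ h

theorem Homotopic.trans {p q r : List V} (h : Homotopic G p q) (h' : Homotopic G q r) :
    Homotopic G p r := Relation.EqvGen.trans _ _ _ h h'

theorem Homotopic.spine (l r : List V) {x b : V} (h : G.Adj x b) :
    Homotopic G (l ++ [x, b, x] ++ r) (l ++ [x] ++ r) := .rel _ _ (.spine l r h)

theorem Homotopic.square (l r : List V) {x b c d : V} (h : IsSquare G [x, b, c, d, x]) :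
    Homotopic G (l ++ [x, b, c, d, x] ++ r) (l ++ [x] ++ r) := .rel _ _ (.square l r h)

theorem Homotopic.context {p q : List V} (h : Homotopic G p q) (l r : List V) :
    Homotopic G (l ++ p ++ r) (l ++ q ++ r) := by
  unfold Homotopic at h
  induction h with
  | rel p q h =>
    cases h with
    | spine l' r' h => simpa [List.append_assoc] using Homotopic.spine (l ++ l') (r' ++ r) h
    | square l' r' h => simpa [List.append_assoc] using Homotopic.square (l ++ l') (r' ++ r) h
  | refl p => exact .refl _
  | symm p q _ ih => exact ih.symm
  | trans p q r _ _ ih ih' => exact ih.trans ih'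

theorem IsSquare.walk {x b c d : V} (h : IsSquare G [x, b, c, d, x]) : Wk G x [b, c, d, x] x := by
  obtain ⟨_, _, _, _, e, h1, h2, h3, h4, -⟩ := isSquare_iff.1 h
  simp only [List.cons.injEq] at e
  obtain ⟨rfl, rfl, rfl, rfl, -⟩ := e
  exact .cons h1 (.cons h2 (.cons h3 (.single h4)))

theorem HomotopyStep.endsAt_iff {a z : V} {p q : List V} (h : HomotopyStep G p q) :
    EndsAt G a p z ↔ EndsAt G a q z := by
  have key : ∀ (l r s : List V) (x : V), Wk G x s x →
      (EndsAt G a (l ++ x :: (s ++ r)) z ↔ EndsAt G a (l ++ x :: r) z) := by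
    intro l r s x hs
    constructor
    · intro h
      obtain ⟨h1, h2⟩ := h.split
      obtain ⟨y, h3, h4⟩ := h2.unappend
      rw [h3.end_unique hs] at h4
      simpa using h1.append h4
    · intro h
      obtain ⟨h1, h2⟩ := h.split
      simpa using h1.append (hs.append h2)
  cases h with
  | @spine l r x b h =>
    simpa using key l r [b, x] x (.cons h (.single (G.symm _ _ h)))
  | @square l r x b c d h => simpa using key l r [b, c, d, x] x h.walk

/-! ### Homotopic walks represent the same vertex of the square cover -/

/-- `p` and `q` represent the same vertex of the square cover. -/
def SameClass (G : LoopGraph V) (a : V) (p q : List V) : Prop :=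
  ∃ hp hq, squareSetoid G a ⟨p, hp⟩ ⟨q, hq⟩

theorem EndsAt.vertex {a z : V} {p : List V} (h : EndsAt G a p z) (hn : NonBacktracking p) :
    IsWalk G p ∧ NonBacktracking p ∧ p.head? = some a := by
  obtain ⟨s, rfl, h⟩ := h
  have := isWalk_iff.2 ⟨s, z, rfl, h⟩
  exact ⟨this.1, hn, this.2⟩

theorem UniversalCoverVertex.endsAt {a : V} (p : UniversalCoverVertex G a) :
    ∃ z, EndsAt G a p.1 z := by
  obtain ⟨s, z, h⟩ := p.exists_walk
  exact ⟨z, s, h⟩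

theorem SameClass.refl {a z : V} {p : List V} (h : EndsAt G a p z) (hn : NonBacktracking p) :
    SameClass G a p p :=
  ⟨h.vertex hn, h.vertex hn, (squareSetoid G a).refl _⟩

theorem SameClass.symm {a : V} {p q : List V} (h : SameClass G a p q) : SameClass G a q p := by
  obtain ⟨hp, hq, h⟩ := h
  exact ⟨hq, hp, (squareSetoid G a).symm h⟩

theorem SameClass.trans {a : V} {p q r : List V} (h : SameClass G a p q)
    (h' : SameClass G a q r) : SameClass G a p r := by
  obtain ⟨hp, hq, h⟩ := h
  obtain ⟨hq', hr, h'⟩ := h'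
  exact ⟨hp, hr, (squareSetoid G a).trans h h'⟩

theorem AddsSquare.sameClass {a z z' : V} {p q : List V} (h : AddsSquare G p q)
    (hp : EndsAt G a p z) (hp' : NonBacktracking p) (hq : EndsAt G a q z')
    (hq' : NonBacktracking q) : SameClass G a p q :=
  ⟨hp.vertex hp', hq.vertex hq', Relation.EqvGen.rel _ _ (.inl h)⟩

theorem AddsSquare.endsAt {a z : V} {p q : List V} (h : AddsSquare G p q)
    (hp : EndsAt G a p z) : EndsAt G a q z := by
  obtain ⟨l, r, x, b, c, d, rfl, hs, rfl⟩ := addsSquare_iff.1 h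
  exact ((HomotopyStep.square l r hs).endsAt_iff.2 (by simpa using hp)).red

theorem exists_of_not_nonBacktracking {p : List V} {v : V} (hp : NonBacktracking p)
    (h : ¬ NonBacktracking (p ++ [v])) : ∃ p' y, p = p' ++ [v, y] := by
  have hp' := hp.reverse
  have h' : ¬ NonBacktracking (v :: p.reverse) := by
    intro hn
    have := hn.reverse
    simp at this
    exact h this
  match hr : p.reverse with
  | [] => rw [hr] at h'; exact absurd (nonBacktracking_short (by simp)) h'
  | [b] => rw [hr] at h'; exact absurd (nonBacktracking_short (by simp)) h'
  | y :: c :: t =>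
    rw [hr] at h' hp'
    rw [nonBacktracking_cons, not_and_or] at h'
    rcases h' with h' | h'
    · refine ⟨t.reverse, y, ?_⟩
      rw [not_not] at h'
      rw [h', ← List.reverse_reverse p, hr]
      simp
    · exact absurd hp' h'

theorem nonBacktracking_join {l t : List V} {v y : V} (h : NonBacktracking (l ++ [v, y]))
    (h' : NonBacktracking (v :: y :: t)) : NonBacktracking (l ++ v :: y :: t) := by
  induction l with
  | nil => exact h'
  | cons a l ih =>
    match l with
    | [] =>
      simp only [List.cons_append, List.nil_append] at h ⊢
      exact nonBacktracking_cons.2 ⟨(nonBacktracking_cons.1 h).1, h'⟩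
    | [b] =>
      simp only [List.cons_append, List.nil_append] at h ih ⊢
      have := nonBacktracking_cons.1 h
      exact nonBacktracking_cons.2 ⟨this.1, ih this.2⟩
    | b :: c :: l =>
      simp only [List.cons_append] at h ih ⊢
      have := nonBacktracking_cons.1 h
      exact nonBacktracking_cons.2 ⟨this.1, ih this.2⟩

theorem red_spine (l r : List V) (x b : V) : red (l ++ x :: b :: x :: r) = red (l ++ x :: r) := by
  simpa using (SpineRemoval.intro l r x b).red_eq

theorem red_red_append (p r : List V) : red (red p ++ r) = red (p ++ r) :=
  red_append_congr (red_red p) r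

/-- Classes of walks can be extended by a letter. -/
theorem AddsSquare.push {a z v : V} {p q : List V} (h : AddsSquare G p q)
    (hp : EndsAt G a p z) (hn : NonBacktracking p) (hv : G.Adj z v) :
    SameClass G a (red (p ++ [v])) (red (q ++ [v])) := by
  have hpv := hp.append (.single hv)
  have hqv := (h.endsAt hp).append (.single hv)
  have main : ∀ {p' q' : List V}, p' = red (p ++ [v]) → q' = red (q ++ [v]) → AddsSquare G p' q' →
      SameClass G a (red (p ++ [v])) (red (q ++ [v])) := by
    rintro p' q' rfl rfl h
    exact h.sameClass hpv.red (red_nonBacktracking _) hqv.red (red_nonBacktracking _)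
  obtain ⟨l, r, x, b, c, d, hlr, hs, rfl⟩ := addsSquare_iff.1 h
  have hW₀ := ((HomotopyStep.square l r hs).endsAt_iff.2 (by simpa [hlr] using hp)).append
    (.single hv)
  by_cases hn' : NonBacktracking (p ++ [v])
  · refine main (red_eq_self hn').symm (red_red_append _ _).symm (addsSquare_iff.2
      ⟨l, r ++ [v], x, b, c, d, by simp [hlr], hs, by simp⟩)
  -- From here on, `v` cancels the last letter `y` of the walk.
  obtain ⟨p', y, rfl⟩ := exists_of_not_nonBacktracking hn hn'
  have hnp' : NonBacktracking (p' ++ [v]) := by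
    refine NonBacktracking.of_append_left (r := [y]) ?_
    simpa using hn
  have e1 : p' ++ [v] = red (p' ++ [v, y] ++ [v]) := by
    have := red_spine p' [] v y
    rw [red_eq_self hnp'] at this
    simpa using this.symm
  rw [red_red_append] at main ⊢
  rcases List.eq_nil_or_concat' r with rfl | ⟨r, y', rfl⟩
  · obtain ⟨rfl, rfl⟩ : l = p' ++ [v] ∧ x = y := by
      have : p' ++ [v] ++ [y] = l ++ [x] := by simpa using hlr
      have := List.append_inj' this rfl
      exact ⟨this.1.symm, by simpa using this.2.symm⟩
    obtain ⟨_, _, _, _, e, h1, h2, h3, h4, h5, h6⟩ := isSquare_iff.1 hs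
    simp only [List.cons.injEq] at e
    obtain ⟨rfl, rfl, rfl, rfl, -⟩ := e
    -- The square sits at the cancelled letter. If it uses the edge to `v`, as its first or its last
    -- edge, then it can be rotated to start at `v`.
    by_cases hb : b = v
    · subst hb
      refine main e1 rfl (addsSquare_iff.2 ⟨p', [], b, c, d, x, rfl,
        isSquare_iff.2 ⟨b, c, d, x, rfl, h2, h3, h4, h1, h6, h5.symm⟩, ?_⟩)
      simpa using red_spine p' [c, d, x, b] b x
    by_cases hd : d = v
    · subst hd
      refine main e1 rfl (addsSquare_iff.2 ⟨p', [], d, x, b, c, rfl,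
        isSquare_iff.2 ⟨d, x, b, c, rfl, h4, h1, h2, h3, h6.symm, h5⟩, ?_⟩)
      simpa using red_spine (p' ++ [d, x, b, c]) [] d x
    -- The square avoids `v` next to `x`, so `p' v x b c d x v` is already reduced. Inserting the
    -- reversed square at its last `x` undoes everything down to `p' v`.
    · have hW : NonBacktracking (p' ++ [v, x, b, c, d, x, v]) := by
        refine nonBacktracking_join hn ?_
        repeat rw [nonBacktracking_cons]
        exact ⟨Ne.symm hb, h5, h6, h5.symm, hd, nonBacktracking_short (by simp)⟩
      have hW' := red_eq_self hW
      simp only [List.append_assoc, List.cons_append, List.nil_append, List.append_nil] at hW₀ ⊢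
      rw [hW']
      refine SameClass.symm ?_
      have hadd : AddsSquare G (p' ++ [v, x, b, c, d, x, v]) (p' ++ [v]) := by
        refine addsSquare_iff.2 ⟨p' ++ [v, x, b, c, d], [v], x, d, c, b, by simp,
          isSquare_iff.2 ⟨x, d, c, b, rfl, G.symm _ _ h4, G.symm _ _ h3, G.symm _ _ h2,
            G.symm _ _ h1, h5, h6.symm⟩, ?_⟩
        have r1 := red_spine (p' ++ [v, x, b, c]) [c, b, x, v] d x
        have r2 := red_spine (p' ++ [v, x, b]) [b, x, v] c d
        have r3 := red_spine (p' ++ [v, x]) [x, v] b c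
        have r4 := red_spine (p' ++ [v]) [v] x b
        have r5 := red_spine p' [] v x
        rw [red_eq_self hnp'] at r5
        simp only [List.append_assoc, List.cons_append, List.nil_append] at r1 r2 r3 r4 r5 ⊢
        rw [r1, r2, r3, r4, r5]
      have hends := hadd.endsAt hW₀
      simp only [List.append_assoc, List.cons_append, List.nil_append] at e1
      rw [← e1]
      exact hadd.sameClass hW₀ hW hends hnp'
  -- The square sits before the cancelled letter and survives the cancellation at the same place.
  · obtain ⟨hl, rfl⟩ : p' ++ [v] = l ++ x :: r ∧ y = y' := by
      have : p' ++ [v] ++ [y] = (l ++ x :: r) ++ [y'] := by simpa using hlr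
      have := List.append_inj' this rfl
      exact ⟨this.1, by simpa using this.2⟩
    refine main e1 ?_ (addsSquare_iff.2 ⟨l, r, x, b, c, d, hl, hs, rfl⟩)
    obtain ⟨m, hm⟩ : ∃ m, x :: r = m ++ [v] := by
      rcases List.eq_nil_or_concat' (x :: r) with h | ⟨m, w, h⟩
      · simp at h
      · rw [h, ← List.append_assoc] at hl
        exact ⟨m, by rw [h, (List.append_inj' hl rfl).2]⟩
    have := red_spine (l ++ [x, b, c, d] ++ m) [] v y
    have e2 : l ++ [x, b, c, d, x] ++ r = l ++ [x, b, c, d] ++ m ++ [v] := by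
      rw [List.append_assoc _ m, ← hm]; simp
    rw [show l ++ [x, b, c, d, x] ++ (r ++ [y]) ++ [v] = l ++ [x, b, c, d, x] ++ r ++ [y, v] by
      simp, e2]
    simpa using this.symm

theorem SameClass.push {a z v : V} {p q : List V} (h : SameClass G a p q)
    (hp : EndsAt G a p z) (hv : G.Adj z v) :
    SameClass G a (red (p ++ [v])) (red (q ++ [v])) := by
  obtain ⟨hp', hq', h⟩ := h
  have key : ∀ p q : UniversalCoverVertex G a, AddsSquare G p.1 q.1 → ∃ z, EndsAt G a p.1 z ∧
      EndsAt G a q.1 z ∧ ∀ v, G.Adj z v → SameClass G a (red (p.1 ++ [v])) (red (q.1 ++ [v])) := by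
    intro p q h
    obtain ⟨z, hz⟩ := p.endsAt
    exact ⟨z, hz, h.endsAt hz, fun v hv => h.push hz p.2.2.1 hv⟩
  have main : ∀ p q : UniversalCoverVertex G a,
      Relation.EqvGen (fun p q : UniversalCoverVertex G a => DifferBySquare G p.1 q.1) p q →
      ∃ z, EndsAt G a p.1 z ∧
      EndsAt G a q.1 z ∧ ∀ v, G.Adj z v → SameClass G a (red (p.1 ++ [v])) (red (q.1 ++ [v])) := by
    intro p q h
    induction h with
    | rel p q h =>
      rcases h with h | h
      · exact key p q h
      · obtain ⟨z, h1, h2, h3⟩ := key q p h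
        exact ⟨z, h2, h1, fun v hv => (h3 v hv).symm⟩
    | refl p =>
      obtain ⟨z, hz⟩ := p.endsAt
      exact ⟨z, hz, hz, fun v hv => .refl (hz.append (.single hv)).red (red_nonBacktracking _)⟩
    | symm p q _ ih =>
      obtain ⟨z, h1, h2, h3⟩ := ih
      exact ⟨z, h2, h1, fun v hv => (h3 v hv).symm⟩
    | trans p q r _ _ ih ih' =>
      obtain ⟨z, h1, h2, h3⟩ := ih
      obtain ⟨z', h1', h2', h3'⟩ := ih'
      obtain rfl := h2.unique h1'
      exact ⟨z, h1, h2', fun v hv => (h3 v hv).trans (h3' v hv)⟩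
  obtain ⟨z', h1, h2, h3⟩ := main _ _ h
  obtain rfl := hp.unique h1
  exact h3 v hv

theorem SameClass.append {a z z' : V} {p q r : List V} (h : SameClass G a p q)
    (hp : EndsAt G a p z) (hr : Wk G z r z') :
    SameClass G a (red (p ++ r)) (red (q ++ r)) := by
  induction r using List.reverseRecOn generalizing z' with
  | nil =>
    obtain ⟨h1, h2, -⟩ := id h
    rwa [List.append_nil, List.append_nil, red_eq_self h1.2.1, red_eq_self h2.2.1]
  | append_singleton r v ih =>
    obtain ⟨y, h1, h2⟩ := hr.unappend
    cases h2 with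
    | cons h2 _ =>
      have := (ih h1).push (hp.append h1).red h2
      rwa [red_red_append, red_red_append, List.append_assoc, List.append_assoc] at this

/-- `AddsSquare` requires reduced words, so the square is added at the end of the reduced prefix,
and the rest of the word is appended by `SameClass.append`. -/
theorem HomotopyStep.sameClass {a z : V} {p q : List V} (h : HomotopyStep G p q)
    (hp : EndsAt G a p z) : SameClass G a (red p) (red q) := by
  cases h with
  | @spine l r x b h =>
    rw [(SpineRemoval.intro l r x b).red_eq] at *
    have := (SpineRemoval.intro l r x b).endsAt hp
    exact .refl this.red (red_nonBacktracking _)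
  | @square l r x b c d h =>
    have hq := (HomotopyStep.square l r h).endsAt_iff.1 hp
    obtain ⟨h1, h2⟩ := EndsAt.split (l := l) (x := x) (r := r) (by simpa using hq)
    obtain ⟨l₀, hl₀⟩ := h1.red.exists_append
    have e : red (l₀ ++ [x, b, c, d, x] ++ []) = red (l ++ [x, b, c, d, x]) := by
      have := red_red_append (l ++ [x]) [b, c, d, x]
      rw [hl₀] at this
      simpa using this
    have hadd : AddsSquare G (red (l ++ [x])) (red (l ++ [x, b, c, d, x])) :=
      addsSquare_iff.2 ⟨l₀, [], x, b, c, d, by rw [hl₀], h, e.symm⟩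
    have := (hadd.sameClass h1.red (red_nonBacktracking _) (hadd.endsAt h1.red)
      (red_nonBacktracking _)).append h1.red h2
    rw [red_red_append, red_red_append] at this
    exact this.symm

theorem Homotopic.sameClass {a z : V} {p q : List V} (h : Homotopic G p q)
    (hp : EndsAt G a p z) : EndsAt G a q z ∧ SameClass G a (red p) (red q) := by
  suffices (EndsAt G a p z ↔ EndsAt G a q z) ∧ (EndsAt G a p z →
      SameClass G a (red p) (red q)) from ⟨this.1.1 hp, this.2 hp⟩
  clear hp
  unfold Homotopic at h
  induction h with
  | rel p q h => exact ⟨h.endsAt_iff, h.sameClass⟩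
  | refl p => exact ⟨Iff.rfl, fun hp => .refl hp.red (red_nonBacktracking _)⟩
  | symm p q _ ih => exact ⟨ih.1.symm, fun hq => (ih.2 (ih.1.2 hq)).symm⟩
  | trans p q r _ _ ih ih' =>
    exact ⟨ih.1.trans ih'.1, fun hp => (ih.2 hp).trans (ih'.2 (ih.1.1 hp))⟩

/-- If every walk with `L + 1` letters is homotopic to a shorter one, then the square cover is
finite. -/
theorem squareCover_isFinite [Finite V] {a : V} {L : ℕ} (hL : 1 ≤ L)
    (h : ∀ s z, Wk G a s z → s.length = L → ∃ q, q.length ≤ L ∧ Homotopic G (a :: s) q) :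
    (squareCover G a).IsFinite := by
  have key : ∀ p z, EndsAt G a p z → ∃ q, q.length ≤ L ∧ Homotopic G p q := by
    intro p
    induction p using List.reverseRecOn with
    | nil => rintro z ⟨s, e, -⟩; simp at e
    | append_singleton p v ih =>
      intro z hz
      rcases eq_or_ne p [] with rfl | hp
      · exact ⟨[v], by simpa using hL, .refl _⟩
      obtain ⟨y, h1, h2⟩ := hz.unappend hp
      obtain ⟨q, hq, hpq⟩ := ih y h1
      have h3 := hpq.context [] [v]
      simp only [List.nil_append] at h3
      obtain ⟨⟨s, e, hs⟩, -⟩ := h3.sameClass hz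
      have hlen := congrArg List.length e
      simp only [List.length_append, List.length_cons, List.length_nil] at hlen
      rcases (show s.length < L ∨ s.length = L by omega) with h4 | h4
      · exact ⟨q ++ [v], by simp; omega, h3⟩
      -- A word built letter by letter needs shortening only when it reaches `L + 1` letters.
      · obtain ⟨q', hq', h5⟩ := h s z hs h4
        exact ⟨q', hq', h3.trans (e ▸ h5)⟩
  classical
  let base : UniversalCoverVertex G a :=
    ⟨[a], EndsAt.vertex ⟨[], rfl, .nil a⟩ (nonBacktracking_short (by simp))⟩
  have hfin : Finite {l : List V // l.length ≤ L} := List.finite_length_le V L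
  refine Finite.of_surjective (fun l : {l : List V // l.length ≤ L} =>
    if hl : IsWalk G (red l.1) ∧ NonBacktracking (red l.1) ∧ (red l.1).head? = some a then
      Quotient.mk (squareSetoid G a) (⟨red l.1, hl⟩ : UniversalCoverVertex G a)
    else Quotient.mk (squareSetoid G a) base) ?_
  intro Q
  obtain ⟨p, rfl⟩ := Quotient.exists_rep Q
  obtain ⟨z, hz⟩ := p.endsAt
  obtain ⟨q, hq, hpq⟩ := key p.1 z hz
  obtain ⟨hp', hq', hc⟩ := (hpq.sameClass hz).2
  refine ⟨⟨q, hq⟩, ?_⟩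
  refine (dif_pos hq').trans (Quotient.sound ((squareSetoid G a).symm ?_))
  have e : (⟨red p.1, hp'⟩ : UniversalCoverVertex G a) = p := Subtype.ext (red_eq_self p.2.2.1)
  rwa [e] at hc

/-! ### Rectangles are null-homotopic -/

/-- The two ways across a cell of the grid. Cells with two equal opposite corners are not squares,
and need no more than backtracks. -/
theorem homotopic_corner {x b c d : V} (h1 : G.Adj x b) (h2 : G.Adj b c) (h3 : G.Adj x d)
    (h4 : G.Adj d c) : Homotopic G [x, b, c] [x, d, c] := by
  by_cases hbd : b = d
  · rw [hbd]; exact .refl _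
  by_cases hxc : x = c
  · subst hxc
    exact (Homotopic.spine [] [] h1).trans (Homotopic.spine [] [] h3).symm
  have hs : IsSquare G [x, b, c, d, x] :=
    isSquare_iff.2 ⟨x, b, c, d, rfl, h1, h2, G.symm _ _ h4, G.symm _ _ h3, hxc, hbd⟩
  have e1 := Homotopic.square [] [d, c] hs
  have e2 := Homotopic.spine [x, b, c] [c] (G.symm _ _ h3)
  have e3 := Homotopic.spine [x, b] [] (G.symm _ _ h4)
  exact (e2.trans e3).symm.trans e1

/-- The word `r (i + 1) … r (i + L)`. -/
def rowTail (r : ℤ → V) (i : ℤ) : ℕ → List V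
  | 0 => []
  | L + 1 => r (i + 1) :: rowTail r (i + 1) L

theorem rowTail_walk {r : ℤ → V} (hr : RowWalk G r) (i : ℤ) (L : ℕ) :
    Wk G (r i) (rowTail r i L) (r (i + L)) := by
  induction L generalizing i with
  | zero => simpa [rowTail] using Wk.nil (r i)
  | succ L ih =>
    have := ih (i + 1)
    rw [add_assoc, add_comm 1 (L : ℤ)] at this
    exact .cons (hr i) (by push_cast; exact this)

theorem rowTail_congr {r r' : ℤ → V} {i i' : ℤ} {L : ℕ}
    (h : ∀ t : ℕ, t ≤ L → r (i + t) = r' (i' + t)) : rowTail r i L = rowTail r' i' L := by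
  induction L generalizing i i' with
  | zero => rfl
  | succ L ih =>
    rw [rowTail, rowTail, ih (i' := i' + 1) fun t ht => ?_]
    · rw [show r (i + 1) = r' (i' + 1) by simpa using h 1 (by omega)]
    · have := h (t + 1) (by omega)
      push_cast at this
      rwa [add_comm (t : ℤ), ← add_assoc, ← add_assoc] at this

/-- The vertical step is moved from the right end to the left end across one cell at a time. -/
theorem homotopic_climb {r r' : ℤ → V} (hr : RowWalk G r) (hr' : RowWalk G r')
    (h : ∀ i, G.Adj (r i) (r' i)) (i : ℤ) (L : ℕ) :
    Homotopic G (r i :: rowTail r i L ++ [r' (i + L)]) (r i :: r' i :: rowTail r' i L) := by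
  induction L generalizing i with
  | zero => simpa [rowTail] using Homotopic.refl [r i, r' i]
  | succ L ih =>
    have h1 := (ih (i + 1)).context [r i] []
    have h2 := (homotopic_corner (hr i) (h (i + 1)) (h i) (hr' i)).context []
      (rowTail r' (i + 1) L)
    rw [show i + 1 + (L : ℤ) = i + ((L + 1 : ℕ) : ℤ) by push_cast; ring] at h1
    simp only [rowTail, List.cons_append, List.nil_append, List.append_nil] at h1 h2 ⊢
    exact h1.trans h2

theorem homotopic_next_row {r r' : ℤ → V} (hr : RowWalk G r) (hr' : RowWalk G r')
    (h : ∀ i, G.Adj (r i) (r' i)) (i : ℤ) (L : ℕ) :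
    Homotopic G (r i :: rowTail r i L)
      ([r i] ++ (r' i :: rowTail r' i L) ++ [r (i + L)]) := by
  have h1 := (homotopic_climb hr hr' h i L).context [] [r (i + L)]
  obtain ⟨l, hl⟩ := EndsAt.exists_append ⟨_, rfl, rowTail_walk hr i L⟩
  rw [hl] at h1 ⊢
  have h2 := Homotopic.spine l [] (h (i + L))
  simp only [List.append_assoc, List.cons_append, List.nil_append, List.append_nil] at h1 h2 ⊢
  exact h2.symm.trans h1

theorem homotopic_rows {x : ℤ × ℤ → V} (hx : x ∈ homShift G) (i j : ℤ) (L m : ℕ) :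
    ∃ c d : List V, c.length = m ∧ d.length = m ∧
      Homotopic G (x (i, j) :: rowTail (fun i => x (i, j)) i L)
        (c ++ (x (i, j + m) :: rowTail (fun i => x (i, j + m)) i L) ++ d) := by
  induction m with
  | zero => exact ⟨[], [], rfl, rfl, by simpa using Homotopic.refl _⟩
  | succ m ih =>
    obtain ⟨c, d, hc, hd, h⟩ := ih
    rw [mem_homShift_iff] at hx
    have h1 := (homotopic_next_row (r := fun i => x (i, j + m))
      (r' := fun i => x (i, j + (m + 1 : ℕ))) (fun i => hx.1 i _) (fun i => hx.1 i _)
      (fun i => by push_cast; rw [← add_assoc]; exact hx.2 i _) i L).context c d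
    refine ⟨c ++ [x (i, j + m)], [x (i + L, j + m)] ++ d, by simp [hc], by simp [hd], ?_⟩
    refine h.trans ?_
    simpa only [List.append_assoc] using h1

theorem homotopic_checker {α β : V} (h : G.Adj α β) (i : ℤ) (L : ℕ) :
    ∃ q : List V, q.length ≤ 2 ∧
      Homotopic G (checker α β i :: rowTail (checker α β) i L) q := by
  induction L using Nat.twoStepInduction generalizing i with
  | zero => exact ⟨[checker α β i], by simp, .refl _⟩
  | one => exact ⟨[checker α β i, checker α β (i + 1)], by simp, .refl _⟩
  | more L ih _ =>
    obtain ⟨q, hq, h'⟩ := ih (i + 1 + 1)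
    refine ⟨q, hq, ?_⟩
    have e : checker α β (i + 1 + 1) = checker α β i := by
      unfold checker; exact if_congr (by omega) rfl rfl
    have h1 := Homotopic.spine [] (rowTail (checker α β) (i + 1 + 1) L) (checker_walk h i)
    rw [e] at h'
    simp only [rowTail, e]
    exact h1.trans h'

/-! ### The lower bound -/

theorem le_setDist_above (n m : ℕ) (hn : 1 ≤ n) :
    m ≤ setDist (block (0, 0) n) (block (0, (n : ℤ) - 1 + m) n) := by
  refine le_csInf ⟨_, (0, 0), ?_, (0, (n : ℤ) - 1 + m), ?_, rfl⟩ ?_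
  · simp [block]; omega
  · simp [block]; omega
  · rintro d ⟨w, hw, w', hw', rfl⟩
    simp only [block, Set.mem_ofPred_eq] at hw hw'
    simp only [supNorm, Prod.fst_sub, Prod.snd_sub]
    omega

/-- Any bi-infinite walk thus occurs as a row of an admissible pattern. -/
theorem diagonal_mem {r : ℤ → V} (hr : RowWalk G r) :
    (fun w : ℤ × ℤ => r (w.1 + w.2)) ∈ homShift G := by
  rw [mem_homShift_iff]
  refine ⟨fun i j => ?_, fun i j => ?_⟩
  · have := hr (i + j)
    rwa [show i + j + 1 = i + 1 + j by ring] at this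
  · have := hr (i + j)
    rwa [show i + j + 1 = i + (j + 1) by ring] at this

theorem diagonal_admissible {r : ℤ → V} (hr : RowWalk G r) (n : ℕ) (c : ℤ) :
    GloballyAdmissible (homShift G) (n := n) fun w => r ((w.1 : ℤ) + ((w.2 : ℤ) + c)) :=
  ⟨_, diagonal_mem hr, (0, c), fun i j => by simp only [zero_add]; rw [add_comm c]⟩

/-- A walk with `L + 1` letters is placed in the top row of a block, below a checkerboard block. The
rectangle between the two rows has height `m' < m + 2 * k` and makes the walk homotopic to at most
`2 * m' + 2 ≤ L` letters. -/
theorem squareCover_isFinite_of_gluesAt [Finite V] {k L m : ℕ} (hL : 2 * m + 4 * k + 2 ≤ L)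
    (h : GluesAt (homShift G) k (L + 1 + 2 * k) m) (a : V) : (squareCover G a).IsFinite := by
  refine squareCover_isFinite (L := L) (by omega) fun s z hs hsl => ?_
  set r : ℤ → V := rowOf a 0 L (a :: s) with hrdef
  have hr : RowWalk G r := rowOf_walk a (by omega) fun i hi => hs.adj_getD a (by omega)
  have hn : (1 : ℤ) ≤ L := by omega
  have hrs : a :: s = r 0 :: rowTail r 0 L := by
    have key : ∀ (s' : List V) (b : V) (i : ℤ),
        (∀ t : ℕ, t ≤ s'.length → r (i + t) = (b :: s').getD t a) →
        b :: s' = r i :: rowTail r i s'.length := by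
      intro s'
      induction s' with
      | nil => intro b i ht; simpa [rowTail] using (ht 0 le_rfl).symm
      | cons y s' ih =>
        intro b i ht
        have h0 : r i = b := by simpa using ht 0 (by omega)
        rw [List.length_cons, rowTail, h0, ← ih y (i + 1) fun t ht' => ?_]
        have := ht (t + 1) (by simpa using ht')
        rw [List.getD_cons_succ] at this
        rw [← this]; congr 1; push_cast; ring
    rw [← hsl]
    refine key s a 0 fun t ht => ?_
    rw [hrdef, rowOf, foldInt_of_mem (by omega) (by omega)]
    simp
  have hadj : G.Adj (r 0) (r 1) := by simpa using hr 0
  -- The offset places `r 0, …, r L` in columns `k` to `k + L` of the top row. The margin of `k`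
  -- columns on each side keeps these columns inside the upper block for every phase shift.
  obtain ⟨x, hx, v, hv, hp, hp'⟩ := h _ _ (diagonal_admissible hr _ (-(L + 3 * k : ℤ)))
    (diagonal_admissible (checker_walk hadj) _ 0) (0, 0) _ (le_setDist_above _ m (by omega))
  have hv1 : v.1.natAbs < k := lt_of_le_of_lt (le_max_left _ _) hv
  have hv2 : v.2.natAbs < k := lt_of_le_of_lt (le_max_right _ _) hv
  -- the top row of the lower block and a row of the upper block
  have hrow : ∀ t : ℕ, t ≤ L → x (k + t, L + 2 * k) = r t := by
    intro t ht
    have := hp ⟨k + t, by omega⟩ ⟨L + 2 * k, by omega⟩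
    simp only [zero_add] at this
    push_cast at this
    rw [this]; congr 1; ring
  -- Row `k` of the upper block stays above the lower block even if the phase shift makes the blocks
  -- overlap.
  obtain ⟨m', hm'⟩ := Int.eq_ofNat_of_zero_le (show 0 ≤ m + v.2 + k by omega)
  have hrow' : ∀ t : ℕ, t ≤ L →
      x (k + t, L + 2 * k + m') = checker (r 0) (r 1) ((2 * k - v.1) + t) := by
    intro t ht
    obtain ⟨i, hi⟩ := Int.eq_ofNat_of_zero_le (show 0 ≤ k + t - v.1 by omega)
    have := hp' ⟨i, by omega⟩ ⟨k, by omega⟩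
    simp only [Prod.fst_add, Prod.snd_add, zero_add, add_zero] at this
    push_cast at this
    rw [show (k : ℤ) + t = v.1 + i by omega,
      show (L : ℤ) + 2 * k + m' = L + 1 + 2 * k - 1 + m + v.2 + k by omega, this]
    congr 1; omega
  obtain ⟨c, d, hc, hd, h1⟩ := homotopic_rows hx k (L + 2 * k) L m'
  obtain ⟨q, hq, h2⟩ := homotopic_checker hadj (2 * k - v.1) L
  refine ⟨c ++ q ++ d, by simp only [List.length_append]; omega, ?_⟩
  rw [hrs]
  have e1 : rowTail (fun i : ℤ => x (i, L + 2 * k)) k L = rowTail r 0 L :=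
    rowTail_congr (by simpa using hrow)
  have e2 : rowTail (fun i : ℤ => x (i, L + 2 * k + m')) k L =
      rowTail (checker (r 0) (r 1)) (2 * k - v.1) L := rowTail_congr hrow'
  rw [e1, e2, show x ((k : ℤ), (L : ℤ) + 2 * k) = r 0 by simpa using hrow 0 (by omega),
    show x ((k : ℤ), (L : ℤ) + 2 * k + m') = _ by simpa using hrow' 0 (by omega)] at h1
  exact h1.trans (h2.context c d)

/-! ### Mixing of the graph -/

theorem exists_adj_of_nonempty (hG : G.Connected) (hX : (homShift G).Nonempty) (a : V) :
    ∃ a', G.Adj a a' := by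
  obtain ⟨x, hx⟩ := hX
  rcases (hG.2 a (x (0, 0))).cases_head with h | ⟨b, h, -⟩
  · exact ⟨_, h ▸ (mem_homShift_iff.1 hx).1 0 0⟩
  · exact ⟨b, h⟩

/-- A walk of bounded length is padded with oscillations between `b` and `b'`; a wrong parity is
repaired by stopping at `b'`. -/
theorem exists_mixes_two [Finite V] (hG : G.Connected) : ∃ T, Mixes G 2 T := by
  have hwalk : ∀ a b, ∃ s, Wk G a s b := by
    intro a b
    induction hG.2 a b with
    | refl => exact ⟨[], .nil a⟩
    | tail _ h ih => obtain ⟨s, hs⟩ := ih; exact ⟨_, hs.append (.single h)⟩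
  choose s hs using hwalk
  obtain ⟨T, hT⟩ := Finite.exists_le fun p : V × V => (s p.1 p.2).length
  refine ⟨T, fun t ht a b b' hb => ?_⟩
  have hl : (s a b).length ≤ T := hT (a, b)
  have hz := fun k => (hs a b).append (zig_walk hb k)
  rcases Nat.even_or_odd' (t - (s a b).length) with ⟨k, hk | hk⟩
  · exact .inl ⟨_, hz k, by simp only [List.length_append, zig_length]; omega⟩
  · exact .inr ⟨le_rfl, _, (hz k).append (.single hb), by
      simp only [List.length_append, zig_length, List.length_singleton]; omega⟩

theorem column_walk {x : ℤ × ℤ → V} (hx : x ∈ homShift G) (t : ℕ) :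
    ∃ s, Wk G (x (0, 0)) s (x (0, t)) ∧ s.length = t := by
  induction t with
  | zero => exact ⟨[], .nil _, rfl⟩
  | succ t ih =>
    obtain ⟨s, hs, hl⟩ := ih
    exact ⟨_, hs.append (.single (by simpa using (mem_homShift_iff.1 hx).2 0 t)), by simp [hl]⟩

/-- With phase 1 there is no shift, so gluing two single letters vertically yields a column that is
a walk of exactly the prescribed length. -/
theorem mixes_one {m : ℕ} (hadj : ∀ a, ∃ a', G.Adj a a') (h : GluesAt (homShift G) 1 1 m) :
    Mixes G 1 m := by
  intro t ht a b _ _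
  have hadm : ∀ a, GloballyAdmissible (homShift G) (n := 1) fun _ => a := by
    intro a
    obtain ⟨a', ha⟩ := hadj a
    refine ⟨_, diagonal_mem (checker_walk ha), (0, 0), fun i j => ?_⟩
    rw [Subsingleton.elim i 0, Subsingleton.elim j 0]
    rfl
  obtain ⟨x, hx, v, hv, h1, h2⟩ := h _ _ (hadm a) (hadm b) (0, 0) (0, (1 : ℕ) - 1 + t)
    (ht.trans (le_setDist_above 1 t le_rfl))
  have hv0 : v = 0 := by
    simp only [supNorm, Nat.lt_one_iff, Nat.max_eq_zero_iff, Int.natAbs_eq_zero] at hv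
    exact Prod.ext hv.1 hv.2
  subst hv0
  obtain ⟨s, hs, hl⟩ := column_walk hx t
  have e1 := h1 0 0
  have e2 := h2 0 0
  simp at e1 e2
  rw [e1, e2] at hs
  exact .inl ⟨s, hs, hl⟩

/-! ### Bounds on the gap function -/

theorem gapFunction_le {A : Type*} {X : Set (ℤ × ℤ → A)} {n : ℕ+} {m : ℕ}
    (h : GluesAt X (phase X) n m) : gapFunction X n ≤ m := Nat.sInf_le h

theorem gluesAt_of_empty {A : Type*} {X : Set (ℤ × ℤ → A)} (hX : ¬ X.Nonempty) (k n m : ℕ) :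
    GluesAt X k n m :=
  fun _ _ ⟨x, hx, _⟩ => absurd ⟨x, hx⟩ hX

theorem exists_gap_bound [Finite V] (hG : G.Connected) :
    IsPhasedBlockGluing (homShift G) ∧
      ∃ C, ∀ (n : ℕ+) (T : ℕ), Unwinds G n T → gapFunction (homShift G) n ≤ 2 * T + C := by
  by_cases hX : (homShift G).Nonempty
  swap
  · exact ⟨⟨1, le_rfl, fun _ => 0, fun n => gluesAt_of_empty hX _ _ _⟩, 0,
      fun n T _ => gapFunction_le (gluesAt_of_empty hX _ _ _)⟩
  obtain ⟨T₂, hT₂⟩ := exists_mixes_two hG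
  have h2 : 2 ∈ {k : ℕ | 1 ≤ k ∧ ∃ f : ℕ+ → ℕ, IsPhasedBlockGluingWith (homShift G) f k} :=
    ⟨by omega, fun n => 2 * n + T₂ + 1, fun n =>
      gluesAt_of_unwinds n.2 (by omega) (unwinds_linear G n.2) hT₂⟩
  refine ⟨⟨2, h2⟩, ?_⟩
  obtain ⟨h1, f, hf⟩ := Nat.sInf_mem ⟨2, h2⟩
  have hle : phase (homShift G) ≤ 2 := Nat.sInf_le h2
  -- The gap function refers to the actual phase, so mixing is needed for that phase. If it is 1,
  -- gluing of patterns of size 1 supplies it.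
  obtain ⟨T₀, hT₀⟩ : ∃ T, Mixes G (phase (homShift G)) T := by
    rcases (show phase (homShift G) = 1 ∨ phase (homShift G) = 2 by unfold phase at *; omega)
      with h | h
    · refine ⟨f 1, ?_⟩
      have := hf 1
      change GluesAt _ (phase (homShift G)) _ _ at this
      rw [h] at this ⊢
      exact mixes_one (exists_adj_of_nonempty hG hX) this
    · exact ⟨T₂, h ▸ hT₂⟩
  exact ⟨T₀ + 1, fun n T hT => gapFunction_le (gluesAt_of_unwinds n.2 h1 hT hT₀)⟩

theorem gap_isO_linear [Finite V] (hG : G.Connected) :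
    IsO (fun n => (gapFunction (homShift G) n : ℝ)) (fun n => (n : ℝ)) := by
  obtain ⟨-, C, hC⟩ := exists_gap_bound hG
  refine ⟨2, by norm_num, C + 1, by positivity, fun n => ?_⟩
  have := hC n n (unwinds_linear G n.2)
  have : (gapFunction (homShift G) n : ℝ) ≤ 2 * (n : ℕ) + C := by exact_mod_cast this
  linarith

theorem gap_isO_log [Finite V] (hG : G.Connected) {a : V} (ha : (squareCover G a).IsFinite) :
    IsO (fun n => (gapFunction (homShift G) n : ℝ)) (fun n => Real.log (n : ℝ)) := by
  by_cases hX : (homShift G).Nonempty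
  swap
  · refine ⟨1, one_pos, 1, one_pos, fun n => ?_⟩
    have : gapFunction (homShift G) n = 0 :=
      Nat.le_zero.1 (gapFunction_le (gluesAt_of_empty hX _ _ _))
    have h : 0 ≤ Real.log ((n : ℕ) : ℝ) := Real.log_natCast_nonneg _
    simp only [this, Nat.cast_zero]
    linarith
  obtain ⟨-, C, hC⟩ := exists_gap_bound hG
  obtain ⟨a', ha'⟩ := exists_adj_of_nonempty hG hX a
  obtain ⟨A⟩ := exists_absorber hG ha' ha
  have hlog2 : 0 < Real.log 2 := Real.log_pos (by norm_num)
  -- With `k = Nat.log 2 n + 1`, the bound `2 * T + C` equals `8 * A.period * (Nat.log 2 n + 3) +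
  -- C`.
  refine ⟨8 * A.period / Real.log 2 + 1, by positivity, 24 * A.period + C + 1, by positivity,
    fun n => ?_⟩
  have hn : (n : ℕ) ≤ A.chunk * 2 ^ (Nat.log 2 n + 1) :=
    (Nat.lt_pow_succ_log_self (by norm_num) _).le.trans
      (Nat.le_mul_of_pos_left _ (by unfold Absorber.chunk; omega))
  have h1 := hC n _ (A.unwinds _ n.2 hn)
  have h2 : (gapFunction (homShift G) n : ℝ) ≤
      2 * (4 * (A.period * ((Nat.log 2 n : ℕ) + 1 + 2))) + C := by exact_mod_cast h1
  have h3 : (Nat.log 2 n : ℝ) * Real.log 2 ≤ Real.log ((n : ℕ) : ℝ) := by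
    rw [← Real.log_pow]
    refine Real.log_le_log (by positivity) ?_
    exact_mod_cast Nat.pow_log_le_self 2 n.ne_zero
  have h4 : (Nat.log 2 n : ℝ) ≤ Real.log ((n : ℕ) : ℝ) / Real.log 2 := by
    rwa [le_div_iff₀ hlog2]
  have h5 : 0 ≤ Real.log ((n : ℕ) : ℝ) := Real.log_natCast_nonneg _
  have h6 : 8 * (A.period : ℝ) * (Nat.log 2 n : ℝ) ≤
      8 * A.period / Real.log 2 * Real.log ((n : ℕ) : ℝ) := by
    rw [div_mul_eq_mul_div, mul_div_assoc]
    exact mul_le_mul_of_nonneg_left h4 (by positivity)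
  linarith

theorem linear_isO_gap [Finite V] (hG : G.Connected) {a : V}
    (ha : ¬ (squareCover G a).IsFinite) :
    IsO (fun n => (n : ℝ)) (fun n => (gapFunction (homShift G) n : ℝ)) := by
  have hglue := (isLeast_gapFunction (exists_gap_bound hG).1).1
  set k := phase (homShift G)
  -- For `L = n - 1 - 2 * k`, the condition `2 * m + 4 * k + 2 ≤ L` fails exactly when `n` is at
  -- most `2 * m + 6 * k + 2`.
  refine ⟨2, by norm_num, 6 * k + 3, by positivity, fun n => ?_⟩
  have : (n : ℕ) ≤ 2 * gapFunction (homShift G) n + (6 * k + 3) := by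
    by_contra hcon
    refine ha (squareCover_isFinite_of_gluesAt (k := k) (L := n - 1 - 2 * k)
      (m := gapFunction (homShift G) n) (by omega) ?_ a)
    rw [show (n : ℕ) - 1 - 2 * k + 1 + 2 * k = n by omega]
    exact hglue n
  have h : ((n : ℕ) : ℝ) ≤ 2 * (gapFunction (homShift G) n : ℝ) + (6 * k + 3) := by
    exact_mod_cast this
  exact h

theorem not_isO_log_of_linear {g : ℕ+ → ℝ} (h : IsO g fun n => Real.log (n : ℝ))
    (h' : IsO (fun n => (n : ℝ)) g) : False := by
  obtain ⟨c, hc, K, hK, h⟩ := h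
  obtain ⟨c', hc', K', hK', h'⟩ := h'
  have hlim := Real.isLittleO_log_id_atTop.bound (show 0 < 1 / (2 * (c' * c)) by positivity)
  have hlim' := tendsto_natCast_atTop_atTop (R := ℝ) |>.eventually hlim
  obtain ⟨n, hn, hn1⟩ := (hlim'.and (Filter.eventually_gt_atTop
    (max 1 ⌈2 * (c' * K + K')⌉₊))).exists
  have hn0 : 0 < n := by omega
  have hbig : 2 * (c' * K + K') < n :=
    (Nat.le_ceil _).trans_lt (by exact_mod_cast lt_of_le_of_lt (le_max_right _ _) hn1)
  have h1 := h ⟨n, hn0⟩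
  have h2 := h' ⟨n, hn0⟩
  simp only [PNat.mk_coe, id, Real.norm_eq_abs, Nat.abs_cast] at h1 h2 hn
  have h3 : Real.log n ≤ 1 / (2 * (c' * c)) * n := (le_abs_self _).trans hn
  have h4 : c' * c * Real.log n ≤ n / 2 := by
    calc c' * c * Real.log n ≤ c' * c * (1 / (2 * (c' * c)) * n) := by gcongr
      _ = n / 2 := by field_simp
  nlinarith [mul_le_mul_of_nonneg_left h1 hc'.le]

end HomShift

theorem mainTheorem1 {V : Type*} [Finite V] (G : HomShift.LoopGraph V) (hG : G.Connected) :
    HomShift.IsPhasedBlockGluing (HomShift.homShift G) ∧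
    (HomShift.IsTheta (fun n => (HomShift.gapFunction (HomShift.homShift G) n : ℝ))
        (fun n => (n : ℝ)) ∨
      HomShift.IsO (fun n => (HomShift.gapFunction (HomShift.homShift G) n : ℝ))
        (fun n => Real.log (n : ℝ))) ∧
    ∀ a : V,
      (¬ (HomShift.squareCover G a).IsFinite ↔
        HomShift.IsTheta (fun n => (HomShift.gapFunction (HomShift.homShift G) n : ℝ))
          (fun n => (n : ℝ))) ∧
      ((HomShift.squareCover G a).IsFinite ↔
        HomShift.IsO (fun n => (HomShift.gapFunction (HomShift.homShift G) n : ℝ))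
          (fun n => Real.log (n : ℝ))) := by
  have hfin := fun (a : V) (ha : (HomShift.squareCover G a).IsFinite) =>
    HomShift.gap_isO_log hG ha
  have hinf : ∀ a : V, ¬ (HomShift.squareCover G a).IsFinite → HomShift.IsTheta
      (fun n => (HomShift.gapFunction (HomShift.homShift G) n : ℝ)) (fun n => (n : ℝ)) :=
    fun a ha => ⟨HomShift.gap_isO_linear hG, HomShift.linear_isO_gap hG ha⟩
  refine ⟨(HomShift.exists_gap_bound hG).1, ?_, fun a => ⟨⟨hinf a, fun h ha => ?_⟩,
    ⟨hfin a, fun h => ?_⟩⟩⟩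
  · obtain ⟨a⟩ := hG.1
    by_cases ha : (HomShift.squareCover G a).IsFinite
    · exact .inr (hfin a ha)
    · exact .inl (hinf a ha)
  · exact HomShift.not_isO_log_of_linear (hfin a ha) h.2
  · by_contra ha
    exact HomShift.not_isO_log_of_linear h (hinf a ha).2
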